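/- Let $\Gamma$ be a finitely generated right-angled Coxeter group with finite generating set $S$ (all entries of its Coxeter matrix lie in $\{0,1,2\}$, where $0$ means "no relation"). Let $C$ be the cone over the barycentric subdivision of the nerve of $(\Gamma,S)$ and let $X$ be the Davis complex, obtained from $\Gamma\times C$ by the simplicial identifications $a\times v_\sigma\sim b\times v_\sigma$ whenever $a^{-1}b\in\Gamma_\sigma$. Here $\sigma$ is a simplex of the nerve or empty, $v_\sigma$ is its barycentre (the cone point if $\sigma=\emptyset$), and $\Gamma_\sigma$ is the subgroup generated by the vertices of $\sigma$. The images $\gamma C$ of $\{\gamma\}\times C$ are the chambers; $C$ is the base chamber. The walls are the fixed point sets $M_r\subset X$ of the reflections $r=\gamma s\gamma^{-1}$ ($\gamma\in\Gamma$, $s\in S$). The chamber $\gamma C$ has one face for each $s\in S$, namely $\gamma C\cap M_{\gamma s\gamma^{-1}}$, which it shares with the adjacent chamber $\gamma sC$. Let $\mathcal M$ be the set of walls, let $F$ be a finite set, and let $\Phi:\mathcal M\to F$ be a colouring such that different walls of the same colour do not intersect. *Levels.* For each colour $f$, the walls of colour $f$ that bound the component containing the base chamber in the complement of all walls of colour $f$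 have level $1$; drop them and repeat the procedure with the remaining walls of colour $f$ to get the walls of level $2$, and so on. *Orientations.* An orientation of the walls chooses for every wall $M$ a component of $X\setminus M$, called the left side of $M$. It alternates by level if every wall has a level and the base chamber is on the left of the walls of odd level and not on the left of those of even level. *Signed tilings.* A signed labelling gives each face of each chamber a label in $F\times\{+,-\}$; write $o(f,\pm)=(f,\mp)$. It is a tiling if the two labels that a common face gets from its two chambers are exchanged by $o$. The geometric resolution of $\Phi$ given by an orientation labels a face, as a face of a chamber, with the colour of its wall and with the sign $+$ if the interior of the chamber is on the left of the wall, and $-$ otherwise. The tiles of a labelling are the labellings of the faces of a chamber that occur in it; its set of faces $\mathcal F$ consists of the labels that occur and their images under $o$. The labelling is strictly balanced if for every nonzero $w:\mathcal F\to\mathbb Z$ with $w\circ o=-w$ there are tiles $t_+,t_-$ with $\sum_{f\in t_+}w(f)>0$ and $\sum_{f\in t_-}w(f)<0$, where the sums run over the faces of the tile, with multiplicity. A labelling $\psi$ is a limit tiling of a labelling $\varphi$ if there is a sequence of homeomorphisms $g_i:X\to X$ mapping chambers to chambers (for example isometries preserving the decomposition into chambers) such that for every chamber the labels of its faces in $\psi$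 are, for all large $i$, those of their images under $g_i$ in $\varphi$. **Theorem.** There is an orientation of the walls that alternates by level. For every such orientation the resulting geometric resolution of $\Phi$ is a tiling and is strictly balanced, and every limit tiling of this resolution is again a tiling and is strictly balanced. -/

import Mathlib

noncomputable section

namespace DavisTiling

/-! ### Sets of tiles and balance -/

/-- A finite set of tiles with a finite set of faces, an involutive opposition function on the
faces, and for every tile the finite family (with multiplicity) of its faces. -/
structure TileSet where
  Tile : Type*
  Face : Type*
  finite_tile : Finite Tile
  finite_face : Finite Face
  opp : Face → Face
  opp_opp : ∀ f, opp (opp f) = f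
  faces : Tile → Multiset Face

/-- A weight function: an integer-valued function on the faces that is odd under opposition. -/
def TileSet.IsWeight (T : TileSet) (w : T.Face → ℤ) : Prop :=
  ∀ f, w (T.opp f) = -w f

/-- Strictly balanced: every nontrivial weight function has a tile of positive total weight and a
tile of negative total weight. -/
def TileSet.StrictlyBalanced (T : TileSet) : Prop :=
  ∀ w : T.Face → ℤ, T.IsWeight w → w ≠ 0 →
    (∃ t, 0 < ((T.faces t).map w).sum) ∧ (∃ t, ((T.faces t).map w).sum < 0)

/-! ### The Davis complex of a right-angled Coxeter group -/

variable {B : Type*} [Fintype B] {M : CoxeterMatrix B}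

/-- Right-angled: all entries of the Coxeter matrix are `0`, `1` or `2`
(`0` stands for "no relation"). -/
def IsRightAngled (M : CoxeterMatrix B) : Prop :=
  ∀ i j, M i j = 0 ∨ M i j = 1 ∨ M i j = 2

/-- The simplices of the nerve (any two different elements commute), together with the empty
set. -/
def IsNerveSimplex (M : CoxeterMatrix B) (σ : Finset B) : Prop :=
  (σ : Set B).Pairwise fun i j => M i j = 2

/-- The cone over the barycentric subdivision of the nerve, in barycentric coordinates: its
vertices are the simplices of the nerve and the cone point `∅`, its simplices are the chains. -/
def Cone (M : CoxeterMatrix B) : Type _ :=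
  {x : Finset B → ℝ // (∀ σ, 0 ≤ x σ) ∧ ∑ σ, x σ = 1 ∧ (∀ σ, x σ ≠ 0 → IsNerveSimplex M σ) ∧
    IsChain (· ⊆ ·) {σ | x σ ≠ 0}}

instance : TopologicalSpace (Cone M) := inferInstanceAs (TopologicalSpace (Subtype _))

open Classical in
/-- The cone point. -/
def conePoint (M : CoxeterMatrix B) : Cone M :=
  ⟨Pi.single ∅ 1, by
    have key : ∀ σ : Finset B, (Pi.single ∅ 1 : Finset B → ℝ) σ ≠ 0 → σ = ∅ := by
      intro σ h
      by_contra hσ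
      exact h (Pi.single_eq_of_ne hσ _)
    refine ⟨fun σ => ?_, by simp, fun σ h => ?_, fun σ hσ τ hτ hne => ?_⟩
    · by_cases hσ : σ = ∅
      · subst hσ; simp
      · simp [Pi.single_eq_of_ne hσ]
    · rw [key σ h]; simp [IsNerveSimplex]
    · exact absurd ((key σ hσ).trans (key τ hτ).symm) hne⟩

variable {W : Type*} [Group W]

/-- The subgroup generated by the vertices of a simplex. -/
def simplexSubgroup (cs : CoxeterSystem M W) (σ : Finset B) : Subgroup W :=
  Subgroup.closure (cs.simple '' (σ : Set B))

/-- The gluing of the chambers `γ × C`: the points `(a, x)` and `(b, x)` are identified when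
`a × v_σ ∼ b × v_σ`, i.e. `a⁻¹ b ∈ Γ_σ`, for every vertex `v_σ` of the simplex carrying `x`. -/
def davisSetoid (cs : CoxeterSystem M W) : Setoid ((_ : W) × Cone M) where
  r p q := p.2 = q.2 ∧ ∀ σ, p.2.1 σ ≠ 0 → p.1⁻¹ * q.1 ∈ simplexSubgroup cs σ
  iseqv :=
    { refl := fun p => ⟨rfl, fun σ _ => by simp [one_mem]⟩
      symm := by
        rintro ⟨a, x⟩ ⟨b, y⟩ ⟨hxy, h⟩
        dsimp only at hxy h
        subst hxy
        refine ⟨rfl, fun σ hσ => ?_⟩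
        have := inv_mem (h σ hσ)
        simpa using this
      trans := by
        rintro ⟨a, x⟩ ⟨b, y⟩ ⟨c, z⟩ ⟨hxy, h⟩ ⟨hyz, h'⟩
        dsimp only at hxy h hyz h'
        subst hxy
        subst hyz
        refine ⟨rfl, fun σ hσ => ?_⟩
        have := mul_mem (h σ hσ) (h' σ hσ)
        simpa [mul_assoc] using this }

/-- The Davis complex (with the quotient topology from the disjoint union of the chambers). -/
def DavisComplex (cs : CoxeterSystem M W) : Type _ := Quotient (davisSetoid cs)

instance (cs : CoxeterSystem M W) : TopologicalSpace (DavisComplex cs) :=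
  inferInstanceAs (TopologicalSpace (Quotient (davisSetoid cs)))

/-- The quotient map `q`. -/
def toDavis (cs : CoxeterSystem M W) (γ : W) (x : Cone M) : DavisComplex cs :=
  Quotient.mk (davisSetoid cs) ⟨γ, x⟩

/-- The action `γ q(α × x) = q(γ α × x)`. -/
instance (cs : CoxeterSystem M W) : MulAction W (DavisComplex cs) where
  smul γ := Quotient.map (fun p => ⟨γ * p.1, p.2⟩) (by
    rintro ⟨a, x⟩ ⟨b, y⟩ ⟨hxy, h⟩
    refine ⟨hxy, fun σ hσ => ?_⟩
    have := h σ hσ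
    simpa [mul_assoc] using this)
  one_smul := by
    rintro ⟨⟨a, x⟩⟩
    exact congrArg (fun g => toDavis cs g x) (one_mul a)
  mul_smul := by
    rintro γ δ ⟨⟨a, x⟩⟩
    exact congrArg (fun g => toDavis cs g x) (mul_assoc γ δ a)

/-- The chamber `γ C`. -/
def chamber (cs : CoxeterSystem M W) (γ : W) : Set (DavisComplex cs) :=
  Set.range (toDavis cs γ)

/-- The cone point of the base chamber `C`. -/
def basePoint (cs : CoxeterSystem M W) : DavisComplex cs := toDavis cs 1 (conePoint M)

/-- The fixed point set of `r`. -/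
def mirror (cs : CoxeterSystem M W) (r : W) : Set (DavisComplex cs) := {x | r • x = x}

/-- The walls: the fixed point sets of the reflections. -/
def Wall (cs : CoxeterSystem M W) : Type _ :=
  {m : Set (DavisComplex cs) // ∃ r, cs.IsReflection r ∧ m = mirror cs r}

/-- The wall `γ M_s` of the reflection `γ s γ⁻¹`. -/
def wallOf (cs : CoxeterSystem M W) (γ : W) (s : B) : Wall cs :=
  ⟨mirror cs (γ * cs.simple s * γ⁻¹), _, ⟨γ, s, rfl⟩, rfl⟩

/-- The face of the chamber `γ C` on its boundary wall `γ M_s`. -/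
def face (cs : CoxeterSystem M W) (γ : W) (s : B) : Set (DavisComplex cs) :=
  chamber cs γ ∩ (wallOf cs γ s).1

/-! ### Orientations and levels of walls -/

/-- An orientation of every wall: one of the components of its complement is called left. -/
structure Orientation (cs : CoxeterSystem M W) where
  left : Wall cs → Set (DavisComplex cs)
  isComponent : ∀ m, ∃ x ∈ m.1ᶜ, left m = connectedComponentIn m.1ᶜ x

/-- `m` is a wall of the family `A` that bounds the component of the base chamber in the
complement of all walls of `A`. -/
def BoundsBase {cs : CoxeterSystem M W} (A : Set (Wall cs)) (m : Wall cs) : Prop :=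
  m ∈ A ∧ (m.1 ∩ closure (connectedComponentIn (⋃ m' ∈ A, m'.1)ᶜ (basePoint cs))).Nonempty

variable {F : Type*}

/-- The walls of colour `f` that are left when those of level at most `n` have been dropped. -/
def remaining {cs : CoxeterSystem M W} (Φ : Wall cs → F) (f : F) : ℕ → Set (Wall cs)
  | 0 => {m | Φ m = f}
  | n + 1 => {m | m ∈ remaining Φ f n ∧ ¬ BoundsBase (remaining Φ f n) m}

/-- The wall `m` has level `n` among the walls of its colour (levels start at one). -/
def HasLevel {cs : CoxeterSystem M W} (Φ : Wall cs → F) (m : Wall cs) (n : ℕ) : Prop :=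
  ∃ k, n = k + 1 ∧ BoundsBase (remaining Φ (Φ m) k) m

/-- The walls of each colour are oriented alternately by level: the base chamber is on the left
of the walls of odd level and on the right of the walls of even level. -/
def Orientation.AlternatesByLevel {cs : CoxeterSystem M W} (O : Orientation cs)
    (Φ : Wall cs → F) : Prop :=
  ∀ m, ∃ n, HasLevel Φ m n ∧ (basePoint cs ∈ O.left m ↔ Odd n)

/-! ### Tilings of the Davis complex with signed coloured faces

Such a tiling is recorded by the signed colour `φ γ s` which the face of the chamber `γ C` on its
wall `γ M_s` has as a face of this chamber. -/

/-- The opposition function on signed colours. -/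
def oppFace (f : F × ℤˣ) : F × ℤˣ := (f.1, -f.2)

/-- Matching rule: the two chambers `γ C` and `γ s C` adjacent along a face induce opposite signed
colours on it. -/
def IsTiling (cs : CoxeterSystem M W) (φ : W → B → F × ℤˣ) : Prop :=
  ∀ γ s, φ (γ * cs.simple s) s = oppFace (φ γ s)

/-- The set of tiles of a tiling: the tiles are the signed colourings of the faces of the chamber
that occur in it, and the faces are the signed colours that occur, and their opposites. -/
def tileSet [Finite F] (φ : W → B → F × ℤˣ) : TileSet where
  Tile := Set.range φ
  Face := {f : F × ℤˣ // ∃ γ s, φ γ s = f ∨ φ γ s = oppFace f}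
  finite_tile := inferInstance
  finite_face := inferInstance
  opp f := ⟨oppFace f.1, by
    obtain ⟨f, γ, s, h⟩ := f
    exact ⟨γ, s, by simpa [oppFace] using h.symm⟩⟩
  opp_opp f := Subtype.ext (by simp [oppFace])
  faces t := Finset.univ.val.map fun s : B =>
    ⟨t.1 s, by obtain ⟨_, γ, rfl⟩ := t; exact ⟨γ, s, Or.inl rfl⟩⟩

open Classical in
/-- The geometric resolution of the tiling by the colouring `Φ` that is given by an orientation of
the walls: a face gets the colour of its wall, and as a face of a chamber it gets the sign `+` if
the interior of the chamber is left of the wall, and `-` otherwise. -/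
def resolution {cs : CoxeterSystem M W} (Φ : Wall cs → F) (O : Orientation cs) :
    W → B → F × ℤˣ :=
  fun γ s => (Φ (wallOf cs γ s),
    if interior (chamber cs γ) ⊆ O.left (wallOf cs γ s) then 1 else -1)

/-- A homeomorphism that maps every chamber to a chamber. -/
def PreservesChambers {cs : CoxeterSystem M W} (g : DavisComplex cs ≃ₜ DavisComplex cs) : Prop :=
  ∀ γ, ∃ γ', g '' chamber cs γ = chamber cs γ'

/-- On the chamber `γ C`, the tiling `ψ` is the pull-back of the tiling `φ` by `g`. -/
def IsPullbackAt {cs : CoxeterSystem M W} (g : DavisComplex cs ≃ₜ DavisComplex cs)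
    (φ ψ : W → B → F × ℤˣ) (γ : W) : Prop :=
  ∃ γ', g '' chamber cs γ = chamber cs γ' ∧
    ∀ s, ∃ s', g '' face cs γ s = face cs γ' s' ∧ ψ γ s = φ γ' s'

/-- `ψ` is a limit tiling of `φ`: there are decomposition preserving homeomorphisms `g i` such that
on every chamber `ψ` is the pull-back of `φ` by `g i` for all large `i`. -/
def IsLimitTiling (cs : CoxeterSystem M W) (φ ψ : W → B → F × ℤˣ) : Prop :=
  ∃ g : ℕ → (DavisComplex cs ≃ₜ DavisComplex cs), (∀ i, PreservesChambers (g i)) ∧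
    ∀ γ, ∃ i₀, ∀ i ≥ i₀, IsPullbackAt (g i) φ ψ γ

end DavisTiling

end

/-!
The proof is combinatorial once walls are described by their reflections. In a right-angled Coxeter
group, crossing the wall between `γ C` and `γ s C` changes the side of no other wall; this comes
from an action of the group on signed group elements (`exists_crossingSign`), which also shows that
the chambers behind the wall of `r` are those with left inversion `r` (`side_eq_crossingSign`).
Hence the two half-spaces of a wall are the components of its complement
(`connectedComponentIn_compl_wall`), and, more generally, two chambers are in the same component of
the complement of a family of walls as soon as no wall of the family separates them.

All chambers along a wall are on the same side of any disjoint wall (`Wall.side_eq_of_disjoint`).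
Indeed, the chambers along the wall of `s` are reached from each other by crossing walls whose
reflections commute with that of `s`, because two simple reflections without a relation have
disjoint half-spaces (`not_side_and_side`). So for a wall of colour `f` the number of walls of
colour `f` that separate it from the base chamber is well defined, and its level is this number
plus one (`hasLevel_iff`). This gives all walls a level, hence an orientation that alternates by
level. Moreover, the sign of a face of colour `f` of the chamber `γ C` is then the parity of the
number of walls of colour `f` that separate `γ C` from the base chamber
(`resolution_snd_eq`): it depends on `γ` and `f` only, and crossing a wall of colour `f` changes the
sign of `f` and no other sign. Labellings with this property are called sign coherent here.

Sign coherence implies the matching rule, and it implies strict balance: given a weight, start at a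
chamber with a face of nonzero weight and keep crossing faces of negative weight. Each crossing
makes one colour nonnegative, so this ends after finitely many steps, at a chamber of positive
total weight (`IsSignCoherent.exists_sum_pos`). Replacing the weight by its negative gives the other
tile. Finally, sign coherence passes to limit tilings, by taking the limit of the signs along an
ultrafilter (`IsSignCoherent.of_isLimitTiling`).
-/

noncomputable section

namespace DavisTiling

/-! ### Separation by walls in a right-angled Coxeter group -/

section Coxeter

variable {B : Type*} {M : CoxeterMatrix B} {W : Type*} [Group W]

/-- The simple reflections are pairwise different: a simple reflection is detected by the
character that is `-1` on it and `1` on all the others. -/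
theorem simple_injective (hM : IsRightAngled M) (cs : CoxeterSystem M W) :
    Function.Injective cs.simple := by
  classical
  intro i j hij
  by_contra hne
  have hlift : M.IsLiftable (fun k => if k = i then (-1 : ℤˣ) else 1) := by
    intro k l
    rcases hM k l with h | h | h
    · rw [h, pow_zero]
    · have : k = l := by
        by_contra hkl
        exact M.off_diagonal k l hkl h
      rw [this, Int.units_mul_self, one_pow]
    · rw [h, Int.units_sq]
  have h := congrArg (cs.lift ⟨_, hlift⟩) hij
  rw [cs.lift_apply_simple, cs.lift_apply_simple, if_pos rfl, if_neg (Ne.symm hne)] at h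
  exact absurd h (by decide)

theorem commute_simple (cs : CoxeterSystem M W) {i j : B} (h : M i j = 2) :
    Commute (cs.simple i) (cs.simple j) := by
  have h2 := cs.simple_mul_simple_pow i j
  rw [h, pow_two] at h2
  have := eq_inv_of_mul_eq_one_left h2
  rwa [mul_inv_rev, cs.inv_simple, cs.inv_simple] at this

/-- A simple reflection acts on signed group elements: it conjugates, and changes the sign of
itself. -/
def signedConj [DecidableEq W] (cs : CoxeterSystem M W) (i : B) : Equiv.Perm (W × ℤˣ) :=
  Function.Involutive.toPerm
    (fun p => (cs.simple i * p.1 * cs.simple i, if p.1 = cs.simple i then -p.2 else p.2)) (by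
      rintro ⟨t, e⟩
      have h : cs.simple i * t * cs.simple i = cs.simple i ↔ t = cs.simple i := by
        constructor
        · intro h
          have := congrArg (fun x => cs.simple i * x) h
          simpa [mul_assoc, mul_eq_one_iff_eq_inv] using this
        · rintro rfl; simp
      by_cases ht : t = cs.simple i
      · simp [ht]
      · simp only [h, ht, if_false]
        simp [mul_assoc])

theorem signedConj_apply [DecidableEq W] (cs : CoxeterSystem M W) (i : B) (p : W × ℤˣ) :
    signedConj cs i p =
      (cs.simple i * p.1 * cs.simple i, if p.1 = cs.simple i then -p.2 else p.2) := rfl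

theorem isLiftable_signedConj [DecidableEq W] (hM : IsRightAngled M) (cs : CoxeterSystem M W) :
    M.IsLiftable (signedConj cs) := by
  intro i j
  have hinv : ∀ k p, signedConj cs k (signedConj cs k p) = p := fun k =>
    Function.Involutive.toPerm_involutive _
  rcases hM i j with h | h | h
  · rw [h, pow_zero]
  · have : i = j := by
      by_contra hij
      exact M.off_diagonal i j hij h
    subst this
    ext1 p
    rw [h, pow_one, Equiv.Perm.mul_apply, hinv, Equiv.Perm.one_apply]
  · have hc := commute_simple cs h
    -- commuting simple reflections have commuting actions
    have hcomm : ∀ p, signedConj cs i (signedConj cs j p) =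
        signedConj cs j (signedConj cs i p) := by
      have fix : ∀ k l, Commute (cs.simple k) (cs.simple l) → ∀ t,
          cs.simple k * t * cs.simple k = cs.simple l ↔ t = cs.simple l := by
        intro k l hkl t
        constructor
        · intro ht
          have : t = cs.simple k * cs.simple l * cs.simple k := by
            rw [← ht]; simp [mul_assoc]
          rw [this, hkl.eq, cs.simple_mul_simple_cancel_right]
        · rintro rfl
          rw [hkl.eq, cs.simple_mul_simple_cancel_right]
      rintro ⟨t, e⟩
      simp only [signedConj_apply, fix i j hc, fix j i hc.symm, Prod.mk.injEq]
      refine ⟨?_, ?_⟩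
      · simp only [← mul_assoc]
        rw [hc.eq, mul_assoc _ (cs.simple j) (cs.simple i), mul_assoc _ (cs.simple i) (cs.simple j),
          hc.eq]
      · split_ifs <;> rfl
    ext1 p
    rw [h, pow_two, Equiv.Perm.mul_apply, Equiv.Perm.mul_apply, Equiv.Perm.mul_apply, hcomm,
      hinv, hinv, Equiv.Perm.one_apply]

open Classical in
/-- The parity of the number of crossings of a gallery from `1` to `γ` with the wall of `r` does not
depend on the gallery. -/
theorem exists_crossingSign (hM : IsRightAngled M) (cs : CoxeterSystem M W) :
    ∃ η : W → W → ℤˣ, (∀ r, η r 1 = 1) ∧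
      ∀ r γ i, η r (γ * cs.simple i) =
        if r = γ * cs.simple i * γ⁻¹ then -η r γ else η r γ := by
  let ρ : W →* Equiv.Perm (W × ℤˣ) := cs.lift ⟨signedConj cs, isLiftable_signedConj hM cs⟩
  have hρ : ∀ i, ρ (cs.simple i) = signedConj cs i := fun i => cs.lift_apply_simple _ i
  have hfst : ∀ γ p, (ρ γ p).1 = γ * p.1 * γ⁻¹ := by
    intro γ
    induction γ using cs.simple_induction_left with
    | one => simp
    | mul_simple_left w i ih =>
      intro p
      rw [map_mul, Equiv.Perm.mul_apply, hρ, signedConj_apply]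
      simp [ih, mul_assoc]
  refine ⟨fun r γ => (ρ γ⁻¹ (r, 1)).2, by simp, ?_⟩
  intro r γ i
  have hiff : (ρ γ⁻¹ (r, 1)).1 = cs.simple i ↔ r = γ * cs.simple i * γ⁻¹ := by
    rw [hfst]
    constructor
    · intro h; rw [← h]; simp [mul_assoc]
    · rintro rfl; simp [mul_assoc]
  simp only [mul_inv_rev, cs.inv_simple, map_mul, Equiv.Perm.mul_apply, hρ]
  rw [signedConj_apply]
  simp only [hiff]

/-- If the crossing sign of `r` changes along a gallery from `1` to `γ`, then `r` is a left
inversion of `γ`: a shortest gallery crosses the wall of `r`, and the reflected rest of it shows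
that `r γ` is shorter. -/
theorem isLeftInversion_of_crossingSign (cs : CoxeterSystem M W) {η : W → W → ℤˣ}
    (h1 : ∀ r, η r 1 = 1)
    (hs : ∀ r γ i, r ≠ γ * cs.simple i * γ⁻¹ → η r (γ * cs.simple i) = η r γ)
    {r γ : W} (h : η r γ ≠ 1) : cs.IsLeftInversion γ r := by
  obtain ⟨ω, hω, rfl⟩ := cs.exists_isReduced γ
  refine cs.isLeftInversion_of_mem_leftInvSeq hω ?_
  clear hω
  induction ω using List.reverseRecOn with
  | nil => simp [h1] at h
  | append_singleton ω i ih =>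
    rw [← List.concat_eq_append] at h ⊢
    rw [cs.leftInvSeq_concat, List.concat_eq_append, List.mem_append]
    by_cases hr : r = cs.wordProd ω * cs.simple i * (cs.wordProd ω)⁻¹
    · exact Or.inr (by simp [hr])
    · rw [cs.wordProd_concat, hs _ _ _ hr] at h
      exact Or.inl (ih h)

theorem crossingSign_mul (cs : CoxeterSystem M W) [DecidableEq W] {η : W → W → ℤˣ}
    (h1 : ∀ r, η r 1 = 1)
    (hs : ∀ r γ i, η r (γ * cs.simple i) = if r = γ * cs.simple i * γ⁻¹ then -η r γ else η r γ)
    (r a γ : W) : η r (a * γ) = η r a * η (a⁻¹ * r * a) γ := by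
  induction γ using cs.simple_induction_right with
  | one => rw [mul_one, h1, mul_one]
  | mul_simple_right w i ih => ?_
  have hiff : r = a * w * cs.simple i * (a * w)⁻¹ ↔
      a⁻¹ * r * a = w * cs.simple i * w⁻¹ := by
    constructor
    · rintro rfl; group
    · intro h
      have : r = a * (a⁻¹ * r * a) * a⁻¹ := by group
      rw [this, h]; group
  rw [← mul_assoc, hs, hs, ih]
  simp only [hiff]
  split_ifs <;> simp

open Classical in
/-- The side of the wall of `r` on which the chamber of `γ` lies: the sign `-1` means that the wall
separates this chamber from the base chamber. -/
def side (cs : CoxeterSystem M W) (r γ : W) : ℤˣ := if cs.IsLeftInversion γ r then -1 else 1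

theorem side_eq_neg_one_iff (cs : CoxeterSystem M W) {r γ : W} :
    side cs r γ = -1 ↔ cs.IsLeftInversion γ r := by
  unfold side
  split_ifs with h <;> simp [h]

theorem side_one (cs : CoxeterSystem M W) (r : W) : side cs r 1 = 1 := by
  simp [side, CoxeterSystem.IsLeftInversion]

theorem side_eq_crossingSign (cs : CoxeterSystem M W) [DecidableEq W] {η : W → W → ℤˣ}
    (h1 : ∀ r, η r 1 = 1)
    (hs : ∀ r γ i, η r (γ * cs.simple i) = if r = γ * cs.simple i * γ⁻¹ then -η r γ else η r γ)
    (r γ : W) : side cs r γ = η r γ := by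
  have hs' : ∀ r γ i, r ≠ γ * cs.simple i * γ⁻¹ → η r (γ * cs.simple i) = η r γ :=
    fun r γ i h => by rw [hs, if_neg h]
  rcases Int.units_eq_one_or (η r γ) with h | h
  · rw [h]
    by_contra hne
    have hinv : cs.IsLeftInversion γ r :=
      (side_eq_neg_one_iff cs).1 ((Int.units_eq_one_or _).resolve_left hne)
    obtain ⟨⟨v, i, hr⟩, hlt⟩ := hinv
    -- the wall of a reflection is crossed once on the way to its mirror image
    have hrr : η r r = -1 := by
      have e2 : η r (v * cs.simple i) = -η r v := by rw [hs, if_pos hr]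
      have e3 := crossingSign_mul cs h1 hs r r v
      have e4 : r * v = v * cs.simple i := by rw [hr]; group
      have hrinv : r⁻¹ * r * r = r := by group
      rw [e4, e2, hrinv] at e3
      rcases Int.units_eq_one_or (η r v) with e | e <;> rw [e] at e3 <;>
        simpa [eq_comm, neg_eq_iff_eq_neg] using e3
    have hflip : η r (r * γ) = -1 := by
      have hrinv : r⁻¹ * r * r = r := by group
      rw [crossingSign_mul cs h1 hs, hrr, hrinv, h, mul_one]
    have h2 := isLeftInversion_of_crossingSign cs h1 hs' (r := r) (γ := r * γ)
      (by rw [hflip]; decide)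
    have hmul : r * (r * γ) = γ := by
      rw [← mul_assoc, (show cs.IsReflection r from ⟨v, i, hr⟩).mul_self, one_mul]
    have := h2.2
    rw [hmul] at this
    exact absurd hlt this.not_gt
  · rw [h, side_eq_neg_one_iff]
    exact isLeftInversion_of_crossingSign cs h1 hs' (by rw [h]; decide)

/-- Passing to an adjacent chamber changes the side of the common wall only. -/
theorem side_mul_simple (hM : IsRightAngled M) (cs : CoxeterSystem M W) [DecidableEq W]
    (r γ : W) (i : B) :
    side cs r (γ * cs.simple i) =
      if r = γ * cs.simple i * γ⁻¹ then -side cs r γ else side cs r γ := by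
  obtain ⟨η, h1, hs⟩ := exists_crossingSign hM cs
  have hs' : ∀ r γ i, η r (γ * cs.simple i) =
      if r = γ * cs.simple i * γ⁻¹ then -η r γ else η r γ := by
    intro r γ i
    rw [hs]
    split_ifs <;> rfl
  rw [side_eq_crossingSign cs h1 hs', side_eq_crossingSign cs h1 hs', hs']

theorem side_mul_simple_of_eq (hM : IsRightAngled M) (cs : CoxeterSystem M W) {r γ : W} {i : B}
    (h : r = γ * cs.simple i * γ⁻¹) : side cs r (γ * cs.simple i) = -side cs r γ := by
  classical rw [side_mul_simple hM, if_pos h]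

theorem side_mul_simple_of_ne (hM : IsRightAngled M) (cs : CoxeterSystem M W) {r γ : W} {i : B}
    (h : r ≠ γ * cs.simple i * γ⁻¹) : side cs r (γ * cs.simple i) = side cs r γ := by
  classical rw [side_mul_simple hM, if_neg h]

theorem side_mul (hM : IsRightAngled M) (cs : CoxeterSystem M W) (r a γ : W) :
    side cs r (a * γ) = side cs r a * side cs (a⁻¹ * r * a) γ := by
  classical exact crossingSign_mul cs (side_one cs) (side_mul_simple hM cs) r a γ

theorem side_simple_ne (hM : IsRightAngled M) (cs : CoxeterSystem M W) {r : W} {i : B}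
    (h : r ≠ cs.simple i) : side cs r (cs.simple i) = 1 := by
  have := side_mul_simple_of_ne hM cs (r := r) (γ := 1) (i := i) (by simpa using h)
  rwa [one_mul, side_one] at this

theorem side_reflection_self (cs : CoxeterSystem M W) {r : W}
    (hr : cs.IsReflection r) : side cs r r = -1 := by
  rw [side_eq_neg_one_iff]
  refine ⟨hr, ?_⟩
  rw [hr.mul_self, cs.length_one, Nat.pos_iff_ne_zero, Ne, cs.length_eq_zero_iff]
  rintro rfl
  simpa using hr.odd_length

/-- Along the last step of a shortest gallery no wall is crossed back. -/
theorem side_of_side_mul_simple (hM : IsRightAngled M) (cs : CoxeterSystem M W) {γ : W} {i : B}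
    (h : cs.IsRightDescent γ i) {r : W} (hr : side cs r (γ * cs.simple i) = -1) :
    side cs r γ = -1 := by
  by_cases hri : r = γ * cs.simple i * γ⁻¹
  · rw [side_eq_neg_one_iff]
    refine ⟨⟨γ, i, hri⟩, ?_⟩
    rw [hri]
    simpa [CoxeterSystem.IsRightDescent] using h
  · rwa [side_mul_simple_of_ne hM cs hri] at hr

/-- Induction along a shortest gallery from the base chamber: it starts at `1`, and each step
crosses a wall away from the base chamber. -/
theorem gallery_induction (hM : IsRightAngled M) (cs : CoxeterSystem M W) {p : W → Prop}
    (one : p 1)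
    (step : ∀ γ i, p γ → (∀ r, side cs r γ = -1 → side cs r (γ * cs.simple i) = -1) →
      side cs (γ * cs.simple i * γ⁻¹) γ = 1 → p (γ * cs.simple i)) (γ : W) : p γ := by
  induction hn : cs.length γ using Nat.strong_induction_on generalizing γ with
  | _ n ih =>
    subst hn
    by_cases hγ : γ = 1
    · rw [hγ]; exact one
    obtain ⟨i, hi⟩ := cs.exists_rightDescent_of_ne_one hγ
    have hback : γ * cs.simple i * cs.simple i = γ := cs.simple_mul_simple_cancel_right i
    have hmono : ∀ r, side cs r (γ * cs.simple i) = -1 →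
        side cs r (γ * cs.simple i * cs.simple i) = -1 := by
      intro r hr
      rw [hback]
      exact side_of_side_mul_simple hM cs hi hr
    have := step (γ * cs.simple i) i (ih _ hi _ rfl) hmono (by
      by_contra hne
      have h1 := (Int.units_eq_one_or _).resolve_left hne
      have h2 := hmono _ h1
      rw [side_mul_simple_of_eq hM cs rfl, h1] at h2
      exact absurd h2 (by decide))
    rwa [hback] at this

/-- Two simple reflections without a relation generate an infinite dihedral group: they act on
`ℤ` by two reflections whose product is a translation. -/
theorem exists_dihedral_action (hM : IsRightAngled M) (cs : CoxeterSystem M W) {i j : B}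
    (h : M i j = 0) : ∃ θ : W →* Equiv.Perm ℤ,
      (∀ x, θ (cs.simple i) x = -x) ∧ ∀ x, θ (cs.simple j) x = 1 - x := by
  classical
  have hij : i ≠ j := by
    rintro rfl
    simp at h
  let f : B → Equiv.Perm ℤ := fun k =>
    if k = i then Equiv.neg ℤ else if k = j then Equiv.subLeft 1 else 1
  have hsq : ∀ k, f k * f k = 1 := by
    intro k
    ext x
    by_cases h1 : k = i
    · simp [f, h1]
    · by_cases h2 : k = j
      · simp [f, h2, hij.symm]
      · simp [f, h1, h2]
  have hlift : M.IsLiftable f := by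
    intro k l
    rcases hM k l with hkl | hkl | hkl
    · rw [hkl, pow_zero]
    · have : k = l := by
        by_contra hne
        exact M.off_diagonal k l hne hkl
      rw [this, hsq, one_pow]
    · have hor : f k = 1 ∨ f l = 1 := by
        by_contra! hne
        have key : ∀ m, f m ≠ 1 → m = i ∨ m = j := by
          intro m hm
          by_contra! hm2
          exact hm (by simp [f, hm2.1, hm2.2])
        rcases key k hne.1 with rfl | rfl <;> rcases key l hne.2 with rfl | rfl
        · simp at hkl
        · rw [h] at hkl; simp at hkl
        · rw [M.symmetric, h] at hkl; simp at hkl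
        · simp at hkl
      rw [hkl, pow_two]
      rcases hor with h1 | h1
      · rw [h1, one_mul, hsq]
      · rw [h1, mul_one, hsq]
  refine ⟨cs.lift ⟨f, hlift⟩, fun x => ?_, fun x => ?_⟩
  · rw [cs.lift_apply_simple]; simp [f]
  · rw [cs.lift_apply_simple]; simp [f, hij.symm]

/-- Galleries of an infinite dihedral group that start with the first generator do not cross the
wall of the second one. -/
theorem side_dihedral (hM : IsRightAngled M) (cs : CoxeterSystem M W) {i j : B} (h : M i j = 0)
    (n : ℕ) :
    side cs (cs.simple j) ((cs.simple i * cs.simple j) ^ n) = 1 ∧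
      side cs (cs.simple j) ((cs.simple i * cs.simple j) ^ n * cs.simple i) = 1 := by
  obtain ⟨θ, hi, hj⟩ := exists_dihedral_action hM cs h
  have hp : ∀ n : ℕ, ∀ x, θ ((cs.simple i * cs.simple j) ^ n) x = x - n := by
    intro n
    induction n with
    | zero => simp
    | succ n ih =>
      intro x
      rw [pow_succ, map_mul, Equiv.Perm.mul_apply, ih, map_mul, Equiv.Perm.mul_apply, hi, hj]
      push_cast
      ring
  have cross1 : ∀ n : ℕ, cs.simple j ≠ (cs.simple i * cs.simple j) ^ n * cs.simple i *
      ((cs.simple i * cs.simple j) ^ n)⁻¹ := by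
    intro n hn
    rw [eq_mul_inv_iff_mul_eq] at hn
    have := congrArg (fun g => θ g 0) hn
    simp only [map_mul θ (cs.simple j), map_mul θ _ (cs.simple i), Equiv.Perm.mul_apply, hp, hi,
      hj] at this
    omega
  have cross2 : ∀ n : ℕ, cs.simple j ≠ (cs.simple i * cs.simple j) ^ n * cs.simple i *
      cs.simple j * ((cs.simple i * cs.simple j) ^ n * cs.simple i)⁻¹ := by
    intro n hn
    rw [eq_mul_inv_iff_mul_eq] at hn
    have := congrArg (fun g => θ g 0) hn
    simp only [map_mul θ (cs.simple j), map_mul θ _ (cs.simple i), map_mul θ _ (cs.simple j),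
      Equiv.Perm.mul_apply, hp, hi, hj] at this
    omega
  have step : ∀ n : ℕ, side cs (cs.simple j) ((cs.simple i * cs.simple j) ^ n) = 1 →
      side cs (cs.simple j) ((cs.simple i * cs.simple j) ^ n * cs.simple i) = 1 := by
    intro n hn
    rw [side_mul_simple_of_ne hM cs (cross1 n), hn]
  induction n with
  | zero =>
    have : side cs (cs.simple j) ((cs.simple i * cs.simple j) ^ 0) = 1 := by
      rw [pow_zero, side_one]
    exact ⟨this, step 0 this⟩
  | succ n ih =>
    have : side cs (cs.simple j) ((cs.simple i * cs.simple j) ^ (n + 1)) = 1 := by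
      rw [pow_succ, ← mul_assoc, side_mul_simple_of_ne hM cs (cross2 n), ih.2]
    exact ⟨this, step _ this⟩

theorem mem_closure_pair_simple (cs : CoxeterSystem M W) {i j : B} {u : W}
    (hu : u ∈ Subgroup.closure {cs.simple i, cs.simple j}) :
    ∃ n : ℕ, (u = (cs.simple i * cs.simple j) ^ n ∨
        u = (cs.simple i * cs.simple j) ^ n * cs.simple i) ∨
      (u = (cs.simple j * cs.simple i) ^ n ∨
        u = (cs.simple j * cs.simple i) ^ n * cs.simple j) := by
  have half : ∀ (i j : B) (n : ℕ) (u : W), (u = (cs.simple i * cs.simple j) ^ n ∨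
        u = (cs.simple i * cs.simple j) ^ n * cs.simple i) →
      ∀ k, k = i ∨ k = j → ∃ n : ℕ, (u * cs.simple k = (cs.simple i * cs.simple j) ^ n ∨
        u * cs.simple k = (cs.simple i * cs.simple j) ^ n * cs.simple i) ∨
      (u * cs.simple k = (cs.simple j * cs.simple i) ^ n ∨
        u * cs.simple k = (cs.simple j * cs.simple i) ^ n * cs.simple j) := by
    rintro i j n u (rfl | rfl) k (rfl | rfl)
    · exact ⟨n, Or.inl (Or.inr rfl)⟩
    · cases n with
      | zero => exact ⟨0, Or.inr (Or.inr (by simp))⟩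
      | succ n =>
        refine ⟨n, Or.inl (Or.inr ?_)⟩
        rw [pow_succ, ← mul_assoc, cs.simple_mul_simple_cancel_right]
    · exact ⟨n, Or.inl (Or.inl (cs.simple_mul_simple_cancel_right _))⟩
    · exact ⟨n + 1, Or.inl (Or.inl (by rw [pow_succ, mul_assoc]))⟩
  have both : ∀ x y : W, y ∈ ({cs.simple i, cs.simple j} : Set W) →
      (∃ n : ℕ, (x = (cs.simple i * cs.simple j) ^ n ∨
        x = (cs.simple i * cs.simple j) ^ n * cs.simple i) ∨
      (x = (cs.simple j * cs.simple i) ^ n ∨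
        x = (cs.simple j * cs.simple i) ^ n * cs.simple j)) →
      (∃ n : ℕ, (x * y = (cs.simple i * cs.simple j) ^ n ∨
        x * y = (cs.simple i * cs.simple j) ^ n * cs.simple i) ∨
      (x * y = (cs.simple j * cs.simple i) ^ n ∨
        x * y = (cs.simple j * cs.simple i) ^ n * cs.simple j)) := by
    rintro x y hy ⟨n, hx | hx⟩
    · rcases hy with rfl | rfl
      · exact half i j n x hx i (Or.inl rfl)
      · exact half i j n x hx j (Or.inr rfl)
    · rcases hy with rfl | rfl
      · obtain ⟨m, hm⟩ := half j i n x hx i (Or.inr rfl)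
        exact ⟨m, hm.symm⟩
      · obtain ⟨m, hm⟩ := half j i n x hx j (Or.inl rfl)
        exact ⟨m, hm.symm⟩
  induction hu using Subgroup.closure_induction_right with
  | one => exact ⟨0, Or.inl (Or.inl (pow_zero _).symm)⟩
  | mul_right x _ y hy hx => exact both x y hy hx
  | mul_inv_cancel x _ y hy hx =>
    have hy' : y⁻¹ = y := by
      rcases hy with rfl | rfl <;> exact cs.inv_simple _
    rw [hy']
    exact both x y hy hx

/-- The half-spaces behind the walls of two simple reflections without a relation are disjoint. -/
theorem not_side_and_side (hM : IsRightAngled M) (cs : CoxeterSystem M W) {i j : B}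
    (h : M i j = 0) (γ : W) :
    ¬ (side cs (cs.simple i) γ = -1 ∧ side cs (cs.simple j) γ = -1) := by
  rintro ⟨h1, h2⟩
  let D : Subgroup W := Subgroup.closure {cs.simple i, cs.simple j}
  have hiD : cs.simple i ∈ D := Subgroup.subset_closure (by simp)
  have hjD : cs.simple j ∈ D := Subgroup.subset_closure (by simp)
  -- a shortest element of the coset `D γ` is on the base side of every wall of `D`
  obtain ⟨u, hu, hmin⟩ : ∃ u ∈ D, ∀ v ∈ D, cs.length (u⁻¹ * γ) ≤ cs.length (v⁻¹ * γ) := by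
    let f : W → ℕ := fun u => cs.length (u⁻¹ * γ)
    have hne : (D : Set W).Nonempty := ⟨1, one_mem D⟩
    exact ⟨Function.argminOn f D hne, Function.argminOn_mem f D hne,
      fun v hv => Function.argminOn_le f D hv⟩
  have hside : ∀ r ∈ D, side cs r γ = side cs r u := by
    intro r hr
    have e := side_mul hM cs r u (u⁻¹ * γ)
    rw [mul_inv_cancel_left] at e
    rw [e]
    rcases Int.units_eq_one_or (side cs (u⁻¹ * r * u) (u⁻¹ * γ)) with h3 | h3
    · rw [h3, mul_one]
    · exfalso
      have h4 := ((side_eq_neg_one_iff cs).1 h3).2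
      have h5 := hmin (r⁻¹ * u) (mul_mem (inv_mem hr) hu)
      have e2 : (r⁻¹ * u)⁻¹ * γ = u⁻¹ * r * u * (u⁻¹ * γ) := by group
      rw [e2] at h5
      omega
  rw [hside _ hiD] at h1
  rw [hside _ hjD] at h2
  obtain ⟨n, (rfl | rfl) | (rfl | rfl)⟩ := mem_closure_pair_simple cs hu
  · rw [(side_dihedral hM cs h n).1] at h2; exact absurd h2 (by decide)
  · rw [(side_dihedral hM cs h n).2] at h2; exact absurd h2 (by decide)
  · rw [(side_dihedral hM cs (M.symmetric i j ▸ h) n).1] at h1; exact absurd h1 (by decide)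
  · rw [(side_dihedral hM cs (M.symmetric i j ▸ h) n).2] at h1; exact absurd h1 (by decide)

end Coxeter

/-! ### Subgroups of simplices and chambers along a wall -/

section Simplices

variable {B : Type*} {M : CoxeterMatrix B} {W : Type*} [Group W]

theorem isNerveSimplex_singleton (M : CoxeterMatrix B) (i : B) : IsNerveSimplex M {i} := by
  simp [IsNerveSimplex]

theorem simple_mem_simplexSubgroup (cs : CoxeterSystem M W) {σ : Finset B} {i : B} (hi : i ∈ σ) :
    cs.simple i ∈ simplexSubgroup cs σ :=
  Subgroup.subset_closure ⟨i, hi, rfl⟩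

theorem mem_simplexSubgroup_empty (cs : CoxeterSystem M W) {g : W} :
    g ∈ simplexSubgroup cs ∅ ↔ g = 1 := by
  simp [simplexSubgroup]

theorem mem_simplexSubgroup_singleton (cs : CoxeterSystem M W) {g : W} {i : B} :
    g ∈ simplexSubgroup cs {i} ↔ g = 1 ∨ g = cs.simple i := by
  constructor
  · intro hg
    induction hg using Subgroup.closure_induction_right with
    | one => exact Or.inl rfl
    | mul_right x _ y hy hx =>
      obtain ⟨k, hk, rfl⟩ := hy
      obtain rfl : k = i := by simpa using hk
      rcases hx with rfl | rfl <;> simp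
    | mul_inv_cancel x _ y hy hx =>
      obtain ⟨k, hk, rfl⟩ := hy
      obtain rfl : k = i := by simpa using hk
      rcases hx with rfl | rfl <;> simp
  · rintro (rfl | rfl)
    · exact one_mem _
    · exact simple_mem_simplexSubgroup cs (by simp)

theorem commute_of_mem_simplexSubgroup (cs : CoxeterSystem M W) {σ : Finset B}
    (hσ : IsNerveSimplex M σ) {g : W} (hg : g ∈ simplexSubgroup cs σ) {i : B} (hi : i ∈ σ) :
    Commute g (cs.simple i) := by
  have hle : simplexSubgroup cs σ ≤ Subgroup.centralizer {cs.simple i} := by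
    refine (Subgroup.closure_le _).2 ?_
    rintro _ ⟨k, hk, rfl⟩
    rw [SetLike.mem_coe, Subgroup.mem_centralizer_singleton_iff]
    by_cases hki : k = i
    · rw [hki]
    · exact (commute_simple cs (hσ hk hi hki)).eq
  exact Subgroup.mem_centralizer_singleton_iff.1 (hle hg)

/-- The walls that separate the chambers of a simplex are walls of its vertices: the gallery can be
chosen inside the abelian group of the simplex. -/
theorem exists_simple_of_side_simplexSubgroup (hM : IsRightAngled M) (cs : CoxeterSystem M W)
    {σ : Finset B} (hσ : IsNerveSimplex M σ) {u r : W} (hu : u ∈ simplexSubgroup cs σ)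
    (hr : side cs r u = -1) : ∃ i ∈ σ, r = cs.simple i := by
  have step : ∀ x ∈ simplexSubgroup cs σ, ∀ y ∈ cs.simple '' (σ : Set B),
      (side cs r x = -1 → ∃ i ∈ σ, r = cs.simple i) →
      side cs r (x * y) = -1 → ∃ i ∈ σ, r = cs.simple i := by
    rintro x hx _ ⟨i, hi, rfl⟩ ih h
    by_cases hri : r = x * cs.simple i * x⁻¹
    · refine ⟨i, hi, ?_⟩
      rw [hri, (commute_of_mem_simplexSubgroup cs hσ hx hi).eq, mul_inv_cancel_right]
    · rw [side_mul_simple_of_ne hM cs hri] at h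
      exact ih h
  induction hu using Subgroup.closure_induction_right with
  | one => rw [side_one] at hr; exact absurd hr (by decide)
  | mul_right x hx y hy ih => exact step x hx y hy ih hr
  | mul_inv_cancel x hx y hy ih =>
    have hy' : y⁻¹ = y := by
      obtain ⟨i, _, rfl⟩ := hy
      exact cs.inv_simple i
    rw [hy'] at hr
    exact step x hx y hy ih hr

theorem exists_simple_of_reflection_mem (hM : IsRightAngled M) (cs : CoxeterSystem M W)
    {σ : Finset B} (hσ : IsNerveSimplex M σ) {r : W} (hr : cs.IsReflection r)
    (h : r ∈ simplexSubgroup cs σ) : ∃ i ∈ σ, r = cs.simple i :=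
  exists_simple_of_side_simplexSubgroup hM cs hσ h (side_reflection_self cs hr)

theorem reflection_ne_one (cs : CoxeterSystem M W) {r : W} (hr : cs.IsReflection r) : r ≠ 1 := by
  rintro rfl
  simpa using hr.odd_length

theorem simple_ne_one (cs : CoxeterSystem M W) (i : B) : cs.simple i ≠ 1 :=
  reflection_ne_one cs (cs.isReflection_simple i)

/-- The chambers along the wall of a simple reflection `i` are reached from the base chamber by
crossing walls orthogonal to it: a wall that separates such a chamber `β C` from the base chamber is
the wall of a conjugate `α k α⁻¹`, where `α` and the simple reflection `k` both commute with `i`. -/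
theorem exists_commuting_crossing (hM : IsRightAngled M) (cs : CoxeterSystem M W) {i j : B}
    {β r : W} (hβ : cs.simple i = β * cs.simple j * β⁻¹) (hr : r ≠ cs.simple i)
    (hside : side cs r β = -1) :
    ∃ α k, Commute α (cs.simple i) ∧ M k i = 2 ∧ r = α * cs.simple k * α⁻¹ := by
  induction hn : cs.length β using Nat.strong_induction_on generalizing β r with
  | _ n ih =>
    subst hn
    have hβ1 : β ≠ 1 := by
      rintro rfl
      rw [side_one] at hside
      exact absurd hside (by decide)
    obtain ⟨k, hk⟩ := cs.exists_leftDescent_of_ne_one hβ1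
    have hkβ : side cs (cs.simple k) β = -1 := by
      rw [side_eq_neg_one_iff, cs.isLeftInversion_simple_iff_isLeftDescent]
      exact hk
    have hiβ : cs.simple i * β = β * cs.simple j := by rw [hβ]; group
    -- otherwise `β` or its mirror image lies behind the walls of both `i` and `k`
    have hki : M k i ≠ 0 := by
      intro h0
      have hne : cs.simple k ≠ cs.simple i := by
        intro h
        rw [simple_injective hM cs h] at h0
        simp at h0
      rcases Int.units_eq_one_or (side cs (cs.simple i) β) with h | h
      · refine not_side_and_side hM cs h0 (cs.simple i * β) ⟨?_, ?_⟩
        · rw [hiβ, side_mul_simple_of_ne hM cs (by rwa [← hβ]), hkβ]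
        · rw [hiβ, side_mul_simple_of_eq hM cs hβ, h]
      · exact not_side_and_side hM cs h0 β ⟨hkβ, h⟩
    have hcomm : Commute (cs.simple k) (cs.simple i) := by
      rcases hM k i with h | h | h
      · exact absurd h hki
      · have : k = i := by
          by_contra hne
          exact M.off_diagonal k i hne h
        rw [this]
      · exact commute_simple cs h
    by_cases hrk : r = cs.simple k
    · refine ⟨1, k, Commute.one_left _, ?_, by simpa using hrk⟩
      rcases hM k i with h | h | h
      · exact absurd h hki
      · have : k = i := by
          by_contra hne
          exact M.off_diagonal k i hne h
        exact absurd (this ▸ hrk) hr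
      · exact h
    · have hinv : (cs.simple k)⁻¹ = cs.simple k := cs.inv_simple k
      have hcancel : cs.simple k * (cs.simple k * β) = β := cs.simple_mul_simple_cancel_left k
      have hside' : side cs (cs.simple k * r * cs.simple k) (cs.simple k * β) = -1 := by
        have := side_mul hM cs r (cs.simple k) (cs.simple k * β)
        rw [hcancel, hside, side_simple_ne hM cs hrk, one_mul, hinv] at this
        exact this.symm
      have hconj : ∀ x y, cs.simple k * x * cs.simple k = y → x = cs.simple k * y * cs.simple k := by
        rintro x _ rfl
        simp [mul_assoc]
      obtain ⟨α, l, hα, hl, hrl⟩ := ih (cs.length (cs.simple k * β)) hk (β := cs.simple k * β)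
        (r := cs.simple k * r * cs.simple k) (by
          have e : cs.simple k * β * cs.simple j * (cs.simple k * β)⁻¹ =
              cs.simple k * (β * cs.simple j * β⁻¹) * (cs.simple k)⁻¹ := by group
          rw [e, ← hβ, hcomm.eq, mul_inv_cancel_right])
        (by
          intro h
          apply hr
          rw [hconj _ _ h, hcomm.eq, cs.simple_mul_simple_cancel_right])
        hside' rfl
      refine ⟨cs.simple k * α, l, hcomm.mul_left hα, hl, ?_⟩
      rw [hconj _ _ hrl, mul_inv_rev, hinv]
      simp only [mul_assoc]

end Simplices

/-! ### Points, chambers and walls of the Davis complex -/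

section Points

variable {B : Type*} [Fintype B] {M : CoxeterMatrix B} {W : Type*} [Group W]

open Classical in
/-- The vertex `v_σ` of the cone. -/
def coneVertex (M : CoxeterMatrix B) (σ : Finset B) (hσ : IsNerveSimplex M σ) : Cone M :=
  ⟨Pi.single σ 1, by
    have key : ∀ τ : Finset B, (Pi.single σ 1 : Finset B → ℝ) τ ≠ 0 → τ = σ := by
      intro τ h
      by_contra hτ
      exact h (Pi.single_eq_of_ne hτ _)
    refine ⟨fun τ => ?_, by simp, fun τ h => by rwa [key τ h], fun τ hτ υ hυ hne => ?_⟩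
    · by_cases hτ : τ = σ
      · subst hτ; simp
      · simp [Pi.single_eq_of_ne hτ]
    · exact absurd ((key τ hτ).trans (key υ hυ).symm) hne⟩

theorem coneVertex_apply_ne_zero {σ τ : Finset B} {hσ : IsNerveSimplex M σ} :
    (coneVertex M σ hσ).1 τ ≠ 0 ↔ τ = σ := by
  constructor
  · intro h
    by_contra hτ
    classical exact h (Pi.single_eq_of_ne hτ _)
  · rintro rfl
    simp [coneVertex]

theorem conePoint_apply_ne_zero {τ : Finset B} : (conePoint M).1 τ ≠ 0 ↔ τ = ∅ := by
  constructor
  · intro h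
    by_contra hτ
    classical exact h (Pi.single_eq_of_ne hτ _)
  · rintro rfl
    simp [conePoint]

theorem exists_apply_ne_zero (x : Cone M) : ∃ σ, x.1 σ ≠ 0 := by
  by_contra! h
  have := x.2.2.1
  simp [h] at this

/-- The point that divides the segment from `x` to the cone point in the ratio `t : (1 - t)`. -/
def contract (x : Cone M) (t : unitInterval) : Cone M :=
  ⟨fun σ => (1 - t) * x.1 σ + t * (conePoint M).1 σ, by
    have h0 := t.2.1
    have h1 := t.2.2
    have supp : ∀ σ, (1 - (t : ℝ)) * x.1 σ + t * (conePoint M).1 σ ≠ 0 → x.1 σ ≠ 0 ∨ σ = ∅ := by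
      intro σ h
      by_contra! hn
      have : (conePoint M).1 σ = 0 := by
        by_contra h'
        exact hn.2.ne_empty (conePoint_apply_ne_zero.1 h')
      simp [hn.1, this] at h
    refine ⟨fun σ => ?_, ?_, fun σ h => ?_, fun σ hσ τ hτ hne => ?_⟩
    · exact add_nonneg (mul_nonneg (by linarith) (x.2.1 σ)) (mul_nonneg h0 ((conePoint M).2.1 σ))
    · rw [Finset.sum_add_distrib, ← Finset.mul_sum, ← Finset.mul_sum, x.2.2.1,
        (conePoint M).2.2.1]
      ring
    · rcases supp σ h with h | rfl
      · exact x.2.2.2.1 σ h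
      · simp [IsNerveSimplex]
    · rcases supp σ hσ with h | rfl
      · rcases supp τ hτ with h' | rfl
        · exact x.2.2.2.2 h h' hne
        · exact Or.inr (Finset.empty_subset _)
      · exact Or.inl (Finset.empty_subset _)⟩

theorem contract_zero (x : Cone M) : contract x 0 = x := by
  apply Subtype.ext
  funext σ
  simp [contract]

theorem contract_one (x : Cone M) : contract x 1 = conePoint M := by
  apply Subtype.ext
  funext σ
  simp [contract]

theorem continuous_contract (x : Cone M) : Continuous (contract x) := by
  refine Continuous.subtype_mk ?_ _
  fun_prop

theorem contract_apply_empty_ne_zero {x : Cone M} {t : unitInterval} (ht : t ≠ 0) :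
    (contract x t).1 ∅ ≠ 0 := by
  have h0 : 0 < (t : ℝ) := lt_of_le_of_ne t.2.1 (fun h => ht (Subtype.ext h.symm))
  have hc : 0 < (conePoint M).1 ∅ :=
    lt_of_le_of_ne ((conePoint M).2.1 ∅) (Ne.symm (conePoint_apply_ne_zero.2 rfl))
  exact (add_pos_of_nonneg_of_pos (mul_nonneg (by linarith [t.2.2]) (x.2.1 ∅))
    (mul_pos h0 hc)).ne'

variable (cs : CoxeterSystem M W)

theorem continuous_toDavis (γ : W) : Continuous (toDavis cs γ) :=
  continuous_quotient_mk'.comp continuous_sigmaMk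

theorem exists_toDavis_eq (p : DavisComplex cs) : ∃ γ x, toDavis cs γ x = p := by
  obtain ⟨⟨γ, x⟩, h⟩ := Quotient.exists_rep p
  exact ⟨γ, x, h⟩

theorem toDavis_eq_iff {γ δ : W} {x y : Cone M} : toDavis cs γ x = toDavis cs δ y ↔
    x = y ∧ ∀ σ, x.1 σ ≠ 0 → γ⁻¹ * δ ∈ simplexSubgroup cs σ :=
  Quotient.eq (r := davisSetoid cs)

/-- A set is open if its traces on the chambers are. -/
theorem isOpen_iff_preimage_toDavis {U : Set (DavisComplex cs)} :
    IsOpen U ↔ ∀ γ, IsOpen (toDavis cs γ ⁻¹' U) := by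
  change IsOpen (Quotient.mk (davisSetoid cs) ⁻¹' U) ↔ _
  rw [isOpen_sigma_iff]
  rfl

theorem smul_toDavis (a γ : W) (x : Cone M) : a • toDavis cs γ x = toDavis cs (a * γ) x := rfl

theorem toDavis_mem_mirror_iff {r γ : W} {x : Cone M} : toDavis cs γ x ∈ mirror cs r ↔
    ∀ σ, x.1 σ ≠ 0 → γ⁻¹ * r * γ ∈ simplexSubgroup cs σ := by
  change r • toDavis cs γ x = toDavis cs γ x ↔ _
  rw [smul_toDavis, eq_comm, toDavis_eq_iff]
  simp [mul_assoc]

/-- A point with a positive coordinate at the cone point lies on no wall. -/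
theorem toDavis_notMem_mirror {r γ : W} (hr : cs.IsReflection r) {x : Cone M} (hx : x.1 ∅ ≠ 0) :
    toDavis cs γ x ∉ mirror cs r := by
  intro h
  have := (toDavis_mem_mirror_iff cs).1 h ∅ hx
  rw [mem_simplexSubgroup_empty] at this
  apply reflection_ne_one cs hr
  have e : r = γ * (γ⁻¹ * r * γ) * γ⁻¹ := by group
  rw [e, this]
  group

theorem toDavis_coneVertex_singleton_mem_mirror {γ r : W} {i : B}
    {hi : IsNerveSimplex M {i}} (hr : cs.IsReflection r) :
    toDavis cs γ (coneVertex M {i} hi) ∈ mirror cs r ↔ r = γ * cs.simple i * γ⁻¹ := by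
  rw [toDavis_mem_mirror_iff]
  simp only [coneVertex_apply_ne_zero, forall_eq, mem_simplexSubgroup_singleton]
  have hne : γ⁻¹ * r * γ ≠ 1 := by
    intro h
    apply reflection_ne_one cs hr
    have e : r = γ * (γ⁻¹ * r * γ) * γ⁻¹ := by group
    rw [e, h]
    group
  constructor
  · intro h
    rw [← h.resolve_left hne]
    group
  · rintro rfl
    right
    group

theorem mirror_injOn {r r' : W} (hr : cs.IsReflection r) (hr' : cs.IsReflection r')
    (h : mirror cs r = mirror cs r') : r = r' := by
  obtain ⟨γ, i, rfl⟩ := hr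
  have h1 := (toDavis_coneVertex_singleton_mem_mirror cs (γ := γ)
    (hi := isNerveSimplex_singleton M i) ⟨γ, i, rfl⟩).2 rfl
  rw [h] at h1
  exact ((toDavis_coneVertex_singleton_mem_mirror cs hr').1 h1).symm

/-- The reflection in a wall; it is unique by `mirror_injOn`. -/
def Wall.reflection {cs : CoxeterSystem M W} (m : Wall cs) : W := m.2.choose

theorem Wall.isReflection {cs : CoxeterSystem M W} (m : Wall cs) :
    cs.IsReflection m.reflection := m.2.choose_spec.1

theorem Wall.eq_mirror {cs : CoxeterSystem M W} (m : Wall cs) :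
    m.1 = mirror cs m.reflection := m.2.choose_spec.2

theorem Wall.reflection_injective {cs : CoxeterSystem M W} :
    Function.Injective (Wall.reflection (cs := cs)) := by
  intro m m' h
  apply Subtype.ext
  rw [m.eq_mirror, m'.eq_mirror, h]

theorem reflection_wallOf (γ : W) (i : B) :
    (wallOf cs γ i).reflection = γ * cs.simple i * γ⁻¹ :=
  mirror_injOn cs (Wall.isReflection _) ⟨γ, i, rfl⟩ (Wall.eq_mirror (wallOf cs γ i)).symm

theorem eq_wallOf_iff {m : Wall cs} {γ : W} {i : B} :
    m = wallOf cs γ i ↔ m.reflection = γ * cs.simple i * γ⁻¹ := by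
  rw [← reflection_wallOf, Wall.reflection_injective.eq_iff]

theorem exists_eq_wallOf (m : Wall cs) : ∃ γ i, m = wallOf cs γ i := by
  obtain ⟨γ, i, h⟩ := m.isReflection
  exact ⟨γ, i, (eq_wallOf_iff cs).2 h⟩

theorem wallOf_mul_simple (γ : W) (i : B) : wallOf cs (γ * cs.simple i) i = wallOf cs γ i := by
  rw [eq_wallOf_iff, reflection_wallOf]
  simp [mul_assoc]

theorem toDavis_notMem_wall (m : Wall cs) (γ : W) {x : Cone M} (hx : x.1 ∅ ≠ 0) :
    toDavis cs γ x ∉ m.1 := by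
  rw [m.eq_mirror]
  exact toDavis_notMem_mirror cs m.isReflection hx

theorem conePoint_apply_empty_ne_zero : (conePoint M).1 ∅ ≠ 0 := conePoint_apply_ne_zero.2 rfl

theorem toDavis_coneVertex_mem_wall {m : Wall cs} {γ : W} {i : B} {hi : IsNerveSimplex M {i}} :
    toDavis cs γ (coneVertex M {i} hi) ∈ m.1 ↔ m = wallOf cs γ i := by
  rw [m.eq_mirror, toDavis_coneVertex_singleton_mem_mirror cs m.isReflection, eq_wallOf_iff]

theorem toDavis_mul_simple_eq {γ : W} {i : B} {x : Cone M}
    (h : toDavis cs γ x ∈ (wallOf cs γ i).1) :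
    toDavis cs (γ * cs.simple i) x = toDavis cs γ x := by
  have h' : toDavis cs γ x ∈ mirror cs (γ * cs.simple i * γ⁻¹) := h
  rw [eq_comm, toDavis_eq_iff]
  rw [toDavis_mem_mirror_iff] at h'
  refine ⟨rfl, fun σ hσ => ?_⟩
  have := h' σ hσ
  simpa [mul_assoc] using this

/-- A chamber that meets a wall has a face on it. -/
theorem exists_eq_wallOf_of_mem (hM : IsRightAngled M) {m : Wall cs} {γ : W} {x : Cone M}
    (h : toDavis cs γ x ∈ m.1) : ∃ i, m = wallOf cs γ i := by
  rw [m.eq_mirror, toDavis_mem_mirror_iff] at h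
  obtain ⟨σ, hσ⟩ := exists_apply_ne_zero x
  have hrefl : cs.IsReflection (γ⁻¹ * m.reflection * γ) := by
    simpa using m.isReflection.conj γ⁻¹
  obtain ⟨i, -, hi⟩ := exists_simple_of_reflection_mem hM cs (x.2.2.2.1 σ hσ) hrefl (h σ hσ)
  refine ⟨i, (eq_wallOf_iff cs).2 ?_⟩
  rw [← hi]
  group

theorem chamber_injective : Function.Injective (chamber cs) := by
  intro γ δ h
  have h1 : toDavis cs γ (conePoint M) ∈ chamber cs δ := h ▸ ⟨_, rfl⟩
  obtain ⟨y, hy⟩ := h1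
  obtain ⟨rfl, h2⟩ := (toDavis_eq_iff cs).1 hy
  have := h2 ∅ conePoint_apply_empty_ne_zero
  rw [mem_simplexSubgroup_empty] at this
  exact (inv_mul_eq_one.1 this).symm

end Points

/-! ### Half-spaces -/

section HalfSpaces

variable {B : Type*} [Fintype B] {M : CoxeterMatrix B} {W : Type*} [Group W]
  {cs : CoxeterSystem M W}

/-- The side of the wall on which the chamber `γ C` lies: `1` is the side of the base chamber. -/
def Wall.side (m : Wall cs) (γ : W) : ℤˣ := DavisTiling.side cs m.reflection γ

theorem Wall.side_one (m : Wall cs) : m.side 1 = 1 := DavisTiling.side_one cs _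

theorem Wall.side_wallOf (hM : IsRightAngled M) (γ : W) (i : B) :
    (wallOf cs γ i).side (γ * cs.simple i) = -(wallOf cs γ i).side γ :=
  side_mul_simple_of_eq hM cs (reflection_wallOf cs γ i)

theorem Wall.side_of_ne (hM : IsRightAngled M) {m : Wall cs} {γ : W} {i : B}
    (h : m ≠ wallOf cs γ i) : m.side (γ * cs.simple i) = m.side γ :=
  side_mul_simple_of_ne hM cs (fun h' => h ((eq_wallOf_iff cs).2 h'))

theorem Wall.exists_eq_wallOf_side (hM : IsRightAngled M) (m : Wall cs) (e : ℤˣ) :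
    ∃ γ i, m = wallOf cs γ i ∧ m.side γ = e := by
  obtain ⟨γ, i, rfl⟩ := exists_eq_wallOf cs m
  by_cases h : (wallOf cs γ i).side γ = e
  · exact ⟨γ, i, rfl, h⟩
  · refine ⟨γ * cs.simple i, i, (wallOf_mul_simple cs γ i).symm, ?_⟩
    rw [Wall.side_wallOf hM]
    rcases Int.units_eq_one_or ((wallOf cs γ i).side γ) with h1 | h1 <;>
      rcases Int.units_eq_one_or e with h2 | h2 <;> rw [h1, h2] at h <;> simp_all

/-- A point off the wall determines the side of its chambers. -/
theorem Wall.side_eq_of_toDavis_eq (hM : IsRightAngled M) {m : Wall cs} {γ δ : W} {x y : Cone M}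
    (h : toDavis cs γ x = toDavis cs δ y) (hm : toDavis cs γ x ∉ m.1) : m.side γ = m.side δ := by
  obtain ⟨rfl, h'⟩ := (toDavis_eq_iff cs).1 h
  rw [m.eq_mirror, toDavis_mem_mirror_iff] at hm
  push Not at hm
  obtain ⟨σ, hσ, hr⟩ := hm
  have e := side_mul hM cs m.reflection γ (γ⁻¹ * δ)
  rw [mul_inv_cancel_left] at e
  rcases Int.units_eq_one_or (DavisTiling.side cs (γ⁻¹ * m.reflection * γ) (γ⁻¹ * δ)) with h1 | h1
  · rw [h1, mul_one] at e
    exact e.symm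
  · obtain ⟨i, hi, hri⟩ :=
      exists_simple_of_side_simplexSubgroup hM cs (x.2.2.2.1 σ hσ) (h' σ hσ) h1
    exact absurd (hri ▸ simple_mem_simplexSubgroup cs hi) hr

/-- The half-space of a wall, without the wall, on the given side. A point off the wall is sorted by
the side of one of its chambers; by `Wall.side_eq_of_toDavis_eq` all of them give the same side. -/
def halfSpace (m : Wall cs) (e : ℤˣ) : Set (DavisComplex cs) :=
  {p | p ∉ m.1 ∧ ∃ γ x, toDavis cs γ x = p ∧ m.side γ = e}

theorem toDavis_mem_halfSpace_iff (hM : IsRightAngled M) {m : Wall cs} {e : ℤˣ} {γ : W}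
    {x : Cone M} :
    toDavis cs γ x ∈ halfSpace m e ↔ toDavis cs γ x ∉ m.1 ∧ m.side γ = e := by
  constructor
  · rintro ⟨h, δ, y, hp, rfl⟩
    exact ⟨h, Wall.side_eq_of_toDavis_eq hM hp.symm h⟩
  · rintro ⟨h, rfl⟩
    exact ⟨h, γ, x, rfl, rfl⟩

theorem isOpen_halfSpace (hM : IsRightAngled M) (m : Wall cs) (e : ℤˣ) :
    IsOpen (halfSpace m e) := by
  rw [isOpen_iff_preimage_toDavis]
  intro γ
  by_cases he : m.side γ = e
  · have : toDavis cs γ ⁻¹' halfSpace m e = ⋃ σ ∈ {σ : Finset B |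
        γ⁻¹ * m.reflection * γ ∉ simplexSubgroup cs σ}, {x : Cone M | x.1 σ ≠ 0} := by
      ext x
      rw [Set.mem_preimage, toDavis_mem_halfSpace_iff hM, m.eq_mirror, toDavis_mem_mirror_iff]
      simp only [he, and_true, Set.mem_iUnion, Set.mem_ofPred_eq, exists_prop]
      push Not
      exact exists_congr fun σ => and_comm
    rw [this]
    refine isOpen_biUnion fun σ _ => ?_
    exact isOpen_ne.preimage ((continuous_apply σ).comp continuous_subtype_val)
  · have : toDavis cs γ ⁻¹' halfSpace m e = ∅ := by
      ext x
      rw [Set.mem_preimage, toDavis_mem_halfSpace_iff hM]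
      simp [he]
    rw [this]
    exact isOpen_empty

theorem disjoint_halfSpace (hM : IsRightAngled M) (m : Wall cs) {e e' : ℤˣ} (h : e ≠ e') :
    Disjoint (halfSpace m e) (halfSpace m e') := by
  rw [Set.disjoint_left]
  intro p hp hp'
  obtain ⟨γ, x, rfl⟩ := exists_toDavis_eq cs p
  exact h (((toDavis_mem_halfSpace_iff hM).1 hp).2.symm.trans
    ((toDavis_mem_halfSpace_iff hM).1 hp').2)

theorem connectedComponentIn_subset_halfSpace (hM : IsRightAngled M) {m : Wall cs} {e : ℤˣ}
    {S : Set (DavisComplex cs)} (hS : Disjoint S m.1) {p : DavisComplex cs}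
    (hp : p ∈ halfSpace m e) : connectedComponentIn S p ⊆ halfSpace m e := by
  by_cases hpS : p ∈ S
  · refine isPreconnected_connectedComponentIn.subset_left_of_subset_union
      (isOpen_halfSpace hM m e) (isOpen_halfSpace hM m (-e)) (disjoint_halfSpace hM m ?_) ?_
      ⟨p, mem_connectedComponentIn hpS, hp⟩
    · intro h
      exact absurd h (units_ne_neg_self e)
    · intro q hq
      have hqm : q ∉ m.1 := Set.disjoint_left.1 hS (connectedComponentIn_subset S p hq)
      obtain ⟨γ, x, rfl⟩ := exists_toDavis_eq cs q
      by_cases h : m.side γ = e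
      · exact Or.inl ⟨hqm, γ, x, rfl, h⟩
      · exact Or.inr ⟨hqm, γ, x, rfl, Int.units_ne_iff_eq_neg.1 h⟩
  · rw [connectedComponentIn_eq_empty hpS]
    exact Set.empty_subset _

/-- The complement of a family of walls contains the segment from a point to the centre of its
chamber. -/
theorem connectedComponentIn_toDavis {A : Set (Wall cs)} {γ : W} {x : Cone M}
    (hx : toDavis cs γ x ∈ (⋃ m ∈ A, m.1)ᶜ) :
    connectedComponentIn (⋃ m ∈ A, m.1)ᶜ (toDavis cs γ x) =
      connectedComponentIn (⋃ m ∈ A, m.1)ᶜ (toDavis cs γ (conePoint M)) := by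
  have hcont : Continuous fun t => toDavis cs γ (contract x t) :=
    (continuous_toDavis cs γ).comp (continuous_contract x)
  have hsub : Set.range (fun t => toDavis cs γ (contract x t)) ⊆ (⋃ m ∈ A, m.1)ᶜ := by
    rintro _ ⟨t, rfl⟩
    by_cases ht : t = 0
    · subst ht
      simpa [contract_zero] using hx
    · simp only [Set.mem_compl_iff, Set.mem_iUnion, not_exists]
      intro m _
      exact toDavis_notMem_wall cs m γ (contract_apply_empty_ne_zero ht)
  have hconn : IsPreconnected (Set.range fun t => toDavis cs γ (contract x t)) :=
    isPreconnected_range hcont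
  refine connectedComponentIn_eq (hconn.subset_connectedComponentIn ⟨0, ?_⟩ hsub ⟨1, ?_⟩)
  · simp [contract_zero]
  · simp [contract_one]

/-- Chambers on the same sides of all walls of a family are joined in their complement: a shortest
gallery between them crosses none of these walls. -/
theorem connectedComponentIn_eq_of_side_eq (hM : IsRightAngled M) {A : Set (Wall cs)} {γ δ : W}
    (h : ∀ m ∈ A, m.side γ = m.side δ) :
    connectedComponentIn (⋃ m ∈ A, m.1)ᶜ (toDavis cs γ (conePoint M)) =
      connectedComponentIn (⋃ m ∈ A, m.1)ᶜ (toDavis cs δ (conePoint M)) := by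
  obtain ⟨β, rfl⟩ : ∃ β, δ = γ * β := ⟨γ⁻¹ * δ, by group⟩
  have hside : ∀ (m : Wall cs) (β : W), m.side γ = m.side (γ * β) ↔
      DavisTiling.side cs (γ⁻¹ * m.reflection * γ) β = 1 := by
    intro m β
    unfold Wall.side
    rw [side_mul hM cs m.reflection γ β, eq_comm, mul_eq_left]
  simp only [hside] at h
  induction β using gallery_induction hM cs with
  | one => rw [mul_one]
  | step β i ih hmono hi =>
    have hβ : ∀ m ∈ A, DavisTiling.side cs (γ⁻¹ * m.reflection * γ) β = 1 := by
      intro m hm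
      by_contra hne
      have := hmono _ ((Int.units_eq_one_or _).resolve_left hne)
      rw [h m hm] at this
      exact absurd this (by decide)
    rw [ih hβ, ← mul_assoc]
    -- the two chambers share the barycentre of their common face, which lies on no other wall
    have hA : wallOf cs (γ * β) i ∉ A := by
      intro hm
      have h1 := (hside _ _).2 (h _ hm)
      have h2 := (hside _ _).2 (hβ _ hm)
      rw [h2, ← mul_assoc, Wall.side_wallOf hM] at h1
      exact absurd h1 (units_ne_neg_self _)
    let v : Cone M := coneVertex M {i} (isNerveSimplex_singleton M i)
    have hv : toDavis cs (γ * β) v ∈ (⋃ m ∈ A, m.1)ᶜ := by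
      simp only [Set.mem_compl_iff, Set.mem_iUnion, not_exists]
      intro m hm hmem
      rw [toDavis_coneVertex_mem_wall] at hmem
      exact hA (hmem ▸ hm)
    have hvv : toDavis cs (γ * β * cs.simple i) v = toDavis cs (γ * β) v :=
      toDavis_mul_simple_eq cs ((toDavis_coneVertex_mem_wall cs).2 rfl)
    rw [← connectedComponentIn_toDavis hv, ← hvv, connectedComponentIn_toDavis (hvv ▸ hv)]

/-- The components of the complement of a wall are its two half-spaces. -/
theorem connectedComponentIn_compl_wall (hM : IsRightAngled M) (m : Wall cs) {γ : W} {x : Cone M}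
    (hx : toDavis cs γ x ∈ m.1ᶜ) :
    connectedComponentIn m.1ᶜ (toDavis cs γ x) = halfSpace m (m.side γ) := by
  apply Set.Subset.antisymm
  · exact connectedComponentIn_subset_halfSpace hM disjoint_compl_left
      ((toDavis_mem_halfSpace_iff hM).2 ⟨hx, rfl⟩)
  · have hU : (⋃ m' ∈ ({m} : Set (Wall cs)), m'.1)ᶜ = m.1ᶜ := by simp
    intro p hp
    obtain ⟨δ, y, rfl⟩ := exists_toDavis_eq cs p
    obtain ⟨hy, hside⟩ := (toDavis_mem_halfSpace_iff hM).1 hp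
    have h1 := connectedComponentIn_eq_of_side_eq hM (A := {m}) (γ := γ) (δ := δ)
      (by simpa using hside.symm)
    rw [← connectedComponentIn_toDavis (by rwa [hU]),
      ← connectedComponentIn_toDavis (γ := δ) (x := y) (by rwa [hU]), hU] at h1
    rw [h1]
    exact mem_connectedComponentIn hy

theorem toDavis_conePoint_mem_halfSpace_iff (hM : IsRightAngled M) {m : Wall cs} {e : ℤˣ} {γ : W} :
    toDavis cs γ (conePoint M) ∈ halfSpace m e ↔ m.side γ = e := by
  rw [toDavis_mem_halfSpace_iff hM,
    and_iff_right (toDavis_notMem_wall cs m γ conePoint_apply_empty_ne_zero)]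

theorem basePoint_mem_halfSpace_iff (hM : IsRightAngled M) {m : Wall cs} {e : ℤˣ} :
    basePoint cs ∈ halfSpace m e ↔ e = 1 := by
  unfold basePoint
  rw [toDavis_conePoint_mem_halfSpace_iff hM, m.side_one, eq_comm]

theorem exists_left_eq_halfSpace (hM : IsRightAngled M) (O : Orientation cs) (m : Wall cs) :
    ∃ e, O.left m = halfSpace m e := by
  obtain ⟨p, hp, h⟩ := O.isComponent m
  obtain ⟨γ, x, rfl⟩ := exists_toDavis_eq cs p
  exact ⟨_, h.trans (connectedComponentIn_compl_wall hM m hp)⟩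

/-- The orientation with prescribed left half-spaces. -/
def Orientation.ofSide (hM : IsRightAngled M) (e : Wall cs → ℤˣ) : Orientation cs where
  left m := halfSpace m (e m)
  isComponent m := by
    obtain ⟨γ, i, -, he⟩ := m.exists_eq_wallOf_side hM (e m)
    have h := toDavis_notMem_wall cs m γ (conePoint_apply_empty_ne_zero (M := M))
    exact ⟨_, h, by rw [connectedComponentIn_compl_wall hM m h, he]⟩

/-! ### Interiors of chambers -/

theorem toDavis_conePoint_mem_interior (γ : W) :
    toDavis cs γ (conePoint M) ∈ interior (chamber cs γ) := by
  refine mem_interior.2 ⟨toDavis cs γ '' {x | x.1 ∅ ≠ 0}, Set.image_subset_range _ _, ?_,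
    ⟨_, conePoint_apply_empty_ne_zero, rfl⟩⟩
  rw [isOpen_iff_preimage_toDavis]
  intro δ
  by_cases h : γ = δ
  · have : toDavis cs δ ⁻¹' (toDavis cs γ '' {x | x.1 ∅ ≠ 0}) = {x : Cone M | x.1 ∅ ≠ 0} := by
      ext x
      constructor
      · rintro ⟨y, hy, hxy⟩
        obtain ⟨rfl, -⟩ := (toDavis_eq_iff cs).1 hxy
        exact hy
      · intro hx
        exact ⟨x, hx, by rw [h]⟩
    rw [this]
    exact isOpen_ne.preimage ((continuous_apply _).comp continuous_subtype_val)
  · have : toDavis cs δ ⁻¹' (toDavis cs γ '' {x | x.1 ∅ ≠ 0}) = ∅ := by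
      ext x
      simp only [Set.mem_preimage, Set.mem_empty_iff_false, iff_false]
      rintro ⟨y, hy, hxy⟩
      obtain ⟨rfl, h'⟩ := (toDavis_eq_iff cs).1 hxy
      have := h' ∅ hy
      rw [mem_simplexSubgroup_empty] at this
      exact h (inv_mul_eq_one.1 this)
    rw [this]
    exact isOpen_empty

/-- A point of a wall of a chamber is not interior: it is a limit of points of the adjacent
chamber. -/
theorem notMem_wallOf_of_mem_interior {γ : W} {i : B} {p : DavisComplex cs}
    (hp : p ∈ interior (chamber cs γ)) : p ∉ (wallOf cs γ i).1 := by
  intro hm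
  obtain ⟨x, rfl⟩ := interior_subset hp
  have hcont : Continuous fun t => toDavis cs (γ * cs.simple i) (contract x t) :=
    (continuous_toDavis cs _).comp (continuous_contract x)
  have hopen := (isOpen_interior (s := chamber cs γ)).preimage hcont
  have h0 : (0 : unitInterval) ∈ (fun t => toDavis cs (γ * cs.simple i) (contract x t)) ⁻¹'
      interior (chamber cs γ) := by
    simpa [contract_zero, toDavis_mul_simple_eq cs hm] using hp
  obtain ⟨t, htU, ht⟩ := (dense_compl_singleton (0 : unitInterval)).inter_open_nonempty _ hopen
    ⟨0, h0⟩
  obtain ⟨y, hy⟩ := interior_subset htU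
  obtain ⟨rfl, h⟩ := (toDavis_eq_iff cs).1 hy
  have := h ∅ (contract_apply_empty_ne_zero ht)
  rw [mem_simplexSubgroup_empty, inv_mul_cancel_left] at this
  exact simple_ne_one cs i this

theorem interior_chamber_subset_halfSpace_iff (hM : IsRightAngled M) {γ : W} {i : B} {e : ℤˣ} :
    interior (chamber cs γ) ⊆ halfSpace (wallOf cs γ i) e ↔ (wallOf cs γ i).side γ = e := by
  constructor
  · intro h
    exact (toDavis_conePoint_mem_halfSpace_iff hM).1 (h (toDavis_conePoint_mem_interior γ))
  · rintro rfl p hp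
    obtain ⟨x, rfl⟩ := interior_subset hp
    exact (toDavis_mem_halfSpace_iff hM).2 ⟨notMem_wallOf_of_mem_interior hp, rfl⟩

/-! ### Walls that bound the component of the base chamber -/

/-- All chambers along a wall lie on the same side of any disjoint wall. -/
theorem Wall.side_eq_of_disjoint (hM : IsRightAngled M) {m m' : Wall cs} {γ δ : W} {i j : B}
    (hγ : m = wallOf cs γ i) (hδ : m = wallOf cs δ j) (hdisj : Disjoint m.1 m'.1) :
    m'.side γ = m'.side δ := by
  have hne : m' ≠ m := by
    rintro rfl
    have hv := (toDavis_coneVertex_mem_wall cs (hi := isNerveSimplex_singleton M i)).2 hγ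
    exact Set.disjoint_iff.1 hdisj ⟨hv, hv⟩
  rw [eq_wallOf_iff] at hγ hδ
  by_contra hs
  have e := side_mul hM cs m'.reflection γ (γ⁻¹ * δ)
  rw [mul_inv_cancel_left] at e
  have h1 : DavisTiling.side cs (γ⁻¹ * m'.reflection * γ) (γ⁻¹ * δ) = -1 := by
    refine (Int.units_eq_one_or _).resolve_left fun h => hs ?_
    rw [h, mul_one] at e
    exact e.symm
  obtain ⟨α, k, hα, hk, hr⟩ := exists_commuting_crossing hM cs (i := i) (j := j) (by
      have : γ⁻¹ * δ * cs.simple j * (γ⁻¹ * δ)⁻¹ = γ⁻¹ * (δ * cs.simple j * δ⁻¹) * γ := by group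
      rw [this, ← hδ, hγ]
      group) (by
      intro h
      apply hne
      apply Wall.reflection_injective
      rw [hγ, ← h]
      group) h1
  -- the barycentre of the face with vertices `k` and `i` of the chamber `γ α C` is on both walls
  classical
  have hσ : IsNerveSimplex M {k, i} := by
    intro a ha b hb hab
    simp only [Finset.coe_insert, Finset.coe_singleton, Set.mem_insert_iff,
      Set.mem_singleton_iff] at ha hb
    rcases ha with rfl | rfl <;> rcases hb with rfl | rfl
    · exact absurd rfl hab
    · exact hk
    · rw [M.symmetric]; exact hk
    · exact absurd rfl hab
  suffices toDavis cs (γ * α) (coneVertex M {k, i} hσ) ∈ m.1 ∩ m'.1 from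
    Set.disjoint_iff.1 hdisj this
  constructor
  · rw [m.eq_mirror, toDavis_mem_mirror_iff]
    simp only [coneVertex_apply_ne_zero, forall_eq]
    have : (γ * α)⁻¹ * m.reflection * (γ * α) = α⁻¹ * (cs.simple i * α) := by rw [hγ]; group
    rw [this, ← hα.eq, inv_mul_cancel_left]
    exact simple_mem_simplexSubgroup cs (by simp)
  · rw [m'.eq_mirror, toDavis_mem_mirror_iff]
    simp only [coneVertex_apply_ne_zero, forall_eq]
    have : (γ * α)⁻¹ * m'.reflection * (γ * α) = α⁻¹ * (γ⁻¹ * m'.reflection * γ) * α := by group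
    rw [this, hr]
    have : α⁻¹ * (α * cs.simple k * α⁻¹) * α = cs.simple k := by group
    rw [this]
    exact simple_mem_simplexSubgroup cs (by simp)

theorem boundsBase_iff (hM : IsRightAngled M) {A : Set (Wall cs)} {m : Wall cs} (hm : m ∈ A)
    (hA : ∀ m' ∈ A, m' ≠ m → Disjoint m.1 m'.1) {γ : W} {i : B} (hγ : m = wallOf cs γ i)
    (hside : m.side γ = 1) :
    BoundsBase A m ↔ ∀ m' ∈ A, m' ≠ m → m'.side γ = 1 := by
  constructor
  · rintro ⟨-, p, hpm, hp⟩ m' hm' hne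
    have hsub : connectedComponentIn (⋃ m' ∈ A, m'.1)ᶜ (basePoint cs) ⊆ halfSpace m' 1 :=
      connectedComponentIn_subset_halfSpace hM
        (disjoint_compl_left.mono_right (Set.subset_biUnion_of_mem (u := fun m : Wall cs => m.1) hm'))
        ((basePoint_mem_halfSpace_iff hM).2 rfl)
    have hpm' : p ∉ m'.1 := Set.disjoint_left.1 (hA m' hm' hne) hpm
    obtain ⟨δ, x, rfl⟩ := exists_toDavis_eq cs p
    obtain ⟨j, hδ⟩ := exists_eq_wallOf_of_mem cs hM hpm
    rw [Wall.side_eq_of_disjoint hM hγ hδ (hA m' hm' hne)]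
    by_contra hs
    obtain ⟨q, hq, hq'⟩ := mem_closure_iff.1 (closure_mono hsub hp) _ (isOpen_halfSpace hM m' (-1))
      ((toDavis_mem_halfSpace_iff hM).2 ⟨hpm', (Int.units_eq_one_or _).resolve_left hs⟩)
    exact Set.disjoint_left.1 (disjoint_halfSpace hM m' (by decide)) hq hq'
  · intro h
    let v : Cone M := coneVertex M {i} (isNerveSimplex_singleton M i)
    refine ⟨hm, toDavis cs γ v, (toDavis_coneVertex_mem_wall cs).2 hγ, ?_⟩
    have hγA : ∀ m' ∈ A, m'.side 1 = m'.side γ := by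
      intro m' hm'
      rw [m'.side_one]
      by_cases hne : m' = m
      · rw [hne, hside]
      · rw [h m' hm' hne]
    have hcomp : connectedComponentIn (⋃ m' ∈ A, m'.1)ᶜ (basePoint cs) =
      connectedComponentIn (⋃ m' ∈ A, m'.1)ᶜ (toDavis cs γ (conePoint M)) :=
        connectedComponentIn_eq_of_side_eq hM hγA
    rw [hcomp]
    have hcont : Continuous fun t => toDavis cs γ (contract v t) :=
      (continuous_toDavis cs γ).comp (continuous_contract v)
    have hmem : ∀ t ∈ ({0}ᶜ : Set unitInterval), toDavis cs γ (contract v t) ∈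
        connectedComponentIn (⋃ m' ∈ A, m'.1)ᶜ (toDavis cs γ (conePoint M)) := by
      intro t ht
      have hU : toDavis cs γ (contract v t) ∈ (⋃ m' ∈ A, m'.1)ᶜ := by
        simp only [Set.mem_compl_iff, Set.mem_iUnion, not_exists]
        intro m' _
        exact toDavis_notMem_wall cs m' γ (contract_apply_empty_ne_zero ht)
      rw [← connectedComponentIn_toDavis hU]
      exact mem_connectedComponentIn hU
    have h0 : (0 : unitInterval) ∈ closure ({0}ᶜ : Set unitInterval) :=
      (dense_compl_singleton (0 : unitInterval)) 0
    have := map_mem_closure hcont h0 hmem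
    simpa [contract_zero] using this

end HalfSpaces

/-! ### Levels of walls -/

section Levels

variable {B : Type*} [Fintype B] {M : CoxeterMatrix B} {W : Type*} [Group W]
  {cs : CoxeterSystem M W} {F : Type*}

/-- Induction along a shortest gallery, in terms of walls. -/
theorem wall_gallery_induction (hM : IsRightAngled M) (cs : CoxeterSystem M W) {p : W → Prop}
    (one : p 1)
    (step : ∀ γ i, p γ → (∀ m : Wall cs, m.side γ = -1 → m.side (γ * cs.simple i) = -1) →
      (wallOf cs γ i).side γ = 1 → p (γ * cs.simple i)) (γ : W) : p γ := by
  refine gallery_induction hM cs one (fun γ i hγ hmono hi => ?_) γ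
  refine step γ i hγ (fun m => hmono m.reflection) ?_
  rw [Wall.side, reflection_wallOf]
  exact hi

/-- The walls of colour `f` that separate the chamber `γ C` from the base chamber. -/
def separating (Φ : Wall cs → F) (f : F) (γ : W) : Set (Wall cs) :=
  {m | Φ m = f ∧ m.side γ = -1}

theorem separating_one (Φ : Wall cs → F) (f : F) : separating Φ f 1 = ∅ := by
  ext m
  simp [separating, m.side_one]

theorem separating_mul_simple_of_eq (hM : IsRightAngled M) (Φ : Wall cs → F) {γ : W} {i : B}
    (h : (wallOf cs γ i).side γ = 1) :
    separating Φ (Φ (wallOf cs γ i)) (γ * cs.simple i) =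
      insert (wallOf cs γ i) (separating Φ (Φ (wallOf cs γ i)) γ) := by
  ext m
  by_cases hm : m = wallOf cs γ i
  · subst hm
    simp [separating, Wall.side_wallOf hM, h]
  · simp [separating, Wall.side_of_ne hM hm, hm]

theorem separating_mul_simple_of_ne (hM : IsRightAngled M) {Φ : Wall cs → F} {f : F} {γ : W}
    {i : B} (h : f ≠ Φ (wallOf cs γ i)) :
    separating Φ f (γ * cs.simple i) = separating Φ f γ := by
  ext m
  by_cases hm : m = wallOf cs γ i
  · subst hm
    simp [separating, h.symm]
  · simp [separating, Wall.side_of_ne hM hm]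

theorem wallOf_notMem_separating {Φ : Wall cs → F} {f : F} {γ : W} {i : B}
    (h : (wallOf cs γ i).side γ = 1) : wallOf cs γ i ∉ separating Φ f γ := by
  rintro ⟨-, h'⟩
  rw [h] at h'
  exact absurd h' (by decide)

theorem finite_separating (hM : IsRightAngled M) (Φ : Wall cs → F) (f : F) (γ : W) :
    (separating Φ f γ).Finite := by
  induction γ using wall_gallery_induction hM cs with
  | one => rw [separating_one]; exact Set.finite_empty
  | step γ i ih _ hi =>
    by_cases hf : f = Φ (wallOf cs γ i)
    · subst hf
      rw [separating_mul_simple_of_eq hM Φ hi]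
      exact ih.insert _
    · rwa [separating_mul_simple_of_ne hM hf]

theorem ncard_separating_mul_simple (hM : IsRightAngled M) (Φ : Wall cs → F) {γ : W} {i : B}
    (h : (wallOf cs γ i).side γ = 1) :
    (separating Φ (Φ (wallOf cs γ i)) (γ * cs.simple i)).ncard =
      (separating Φ (Φ (wallOf cs γ i)) γ).ncard + 1 := by
  rw [separating_mul_simple_of_eq hM Φ h,
    Set.ncard_insert_of_notMem (wallOf_notMem_separating h) (finite_separating hM Φ _ γ)]

/-- The number of walls with the colour of `m` that separate `m` from the base chamber, counted
at a chosen chamber along `m` on the base side; `depth_eq` shows that the choice does not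
matter. -/
def depth (hM : IsRightAngled M) (Φ : Wall cs → F) (m : Wall cs) : ℕ :=
  (separating Φ (Φ m) (m.exists_eq_wallOf_side hM 1).choose).ncard

theorem depth_eq (hM : IsRightAngled M) {Φ : Wall cs → F}
    (hΦ : ∀ m m' : Wall cs, m ≠ m' → Φ m = Φ m' → Disjoint m.1 m'.1) {m : Wall cs} {γ : W} {i : B}
    (hγ : m = wallOf cs γ i) (hside : m.side γ = 1) :
    depth hM Φ m = (separating Φ (Φ m) γ).ncard := by
  obtain ⟨j, hδ, hδside⟩ := (m.exists_eq_wallOf_side hM 1).choose_spec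
  unfold depth
  congr 1
  ext m'
  refine and_congr_right fun hm' => ?_
  by_cases hne : m' = m
  · rw [hne, hside, hδside]
  · rw [Wall.side_eq_of_disjoint hM hδ hγ (hΦ m m' (Ne.symm hne) hm'.symm)]

/-- A shortest gallery to a chamber crosses every wall that separates it from the base chamber. -/
theorem exists_crossing (hM : IsRightAngled M) {m : Wall cs} {γ : W} (h : m.side γ = -1) :
    ∃ δ i, m = wallOf cs δ i ∧ m.side δ = 1 ∧ ∀ m' : Wall cs, m'.side δ = -1 → m'.side γ = -1 := by
  induction γ using wall_gallery_induction hM cs with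
  | one => rw [m.side_one] at h; exact absurd h (by decide)
  | step γ i ih hmono hi =>
    by_cases hm : m = wallOf cs γ i
    · exact ⟨γ, i, hm, hm ▸ hi, hmono⟩
    · rw [Wall.side_of_ne hM hm] at h
      obtain ⟨δ, j, h1, h2, h3⟩ := ih h
      exact ⟨δ, j, h1, h2, fun m' hm' => hmono m' (h3 m' hm')⟩

theorem depth_lt (hM : IsRightAngled M) {Φ : Wall cs → F}
    (hΦ : ∀ m m' : Wall cs, m ≠ m' → Φ m = Φ m' → Disjoint m.1 m'.1) {m : Wall cs} {f : F} {γ : W}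
    (h : m ∈ separating Φ f γ) : depth hM Φ m < (separating Φ f γ).ncard := by
  obtain ⟨rfl, hside⟩ := h
  obtain ⟨δ, i, h1, h2, h3⟩ := exists_crossing hM hside
  rw [depth_eq hM hΦ h1 h2]
  refine Set.ncard_lt_ncard ?_ (finite_separating hM Φ _ γ)
  have hsub : separating Φ (Φ m) δ ⊆ separating Φ (Φ m) γ := fun m' hm' => ⟨hm'.1, h3 m' hm'.2⟩
  refine (Set.ssubset_iff_of_subset hsub).2 ⟨m, ⟨rfl, hside⟩, ?_⟩
  rintro ⟨-, h4⟩
  rw [h2] at h4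
  exact absurd h4 (by decide)

theorem exists_depth_eq (hM : IsRightAngled M) {Φ : Wall cs → F}
    (hΦ : ∀ m m' : Wall cs, m ≠ m' → Φ m = Φ m' → Disjoint m.1 m'.1) {f : F} {γ : W} {k : ℕ}
    (hk : k < (separating Φ f γ).ncard) : ∃ m ∈ separating Φ f γ, depth hM Φ m = k := by
  induction γ using wall_gallery_induction hM cs with
  | one => simp [separating_one] at hk
  | step γ i ih hmono hi =>
    by_cases hlt : k < (separating Φ f γ).ncard
    · obtain ⟨m, hm, hmk⟩ := ih hlt
      exact ⟨m, ⟨hm.1, hmono m hm.2⟩, hmk⟩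
    · by_cases hf : f = Φ (wallOf cs γ i)
      · subst hf
        refine ⟨wallOf cs γ i, ?_, ?_⟩
        · rw [separating_mul_simple_of_eq hM Φ hi]
          exact Set.mem_insert _ _
        · rw [ncard_separating_mul_simple hM Φ hi] at hk
          rw [depth_eq hM hΦ rfl hi]
          omega
      · rw [separating_mul_simple_of_ne hM hf] at hk
        exact absurd hk hlt

theorem boundsBase_iff_depth_eq (hM : IsRightAngled M) {Φ : Wall cs → F}
    (hΦ : ∀ m m' : Wall cs, m ≠ m' → Φ m = Φ m' → Disjoint m.1 m'.1) {f : F} {k : ℕ}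
    {m : Wall cs} :
    BoundsBase {m | Φ m = f ∧ k ≤ depth hM Φ m} m ↔ Φ m = f ∧ depth hM Φ m = k := by
  by_cases hm : Φ m = f ∧ k ≤ depth hM Φ m
  · obtain ⟨γ, i, hγ, hside⟩ := m.exists_eq_wallOf_side hM 1
    have hd := depth_eq hM hΦ hγ hside
    rw [boundsBase_iff hM hm (fun m' hm' hne => hΦ m m' hne.symm (hm.1.trans hm'.1.symm)) hγ hside]
    rw [hm.1] at hd
    constructor
    · intro h
      refine ⟨hm.1, ?_⟩
      by_contra hne
      obtain ⟨m', hm', hk⟩ := exists_depth_eq hM hΦ (f := f) (γ := γ) (k := k)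
        (by have := hm.2; omega)
      have hmm : m' ≠ m := by
        rintro rfl
        have := hm'.2
        rw [hside] at this
        exact absurd this (by decide)
      have := h m' ⟨hm'.1, hk.ge⟩ hmm
      rw [hm'.2] at this
      exact absurd this (by decide)
    · rintro ⟨-, hk⟩ m' ⟨hf', hk'⟩ -
      by_contra hne
      have := depth_lt hM hΦ (m := m') (f := f) (γ := γ)
        ⟨hf', (Int.units_eq_one_or _).resolve_left hne⟩
      omega
  · constructor
    · exact fun h => absurd h.1 hm
    · exact fun h => absurd ⟨h.1, h.2.ge⟩ hm

theorem remaining_eq (hM : IsRightAngled M) {Φ : Wall cs → F}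
    (hΦ : ∀ m m' : Wall cs, m ≠ m' → Φ m = Φ m' → Disjoint m.1 m'.1) (f : F) (k : ℕ) :
    remaining Φ f k = {m | Φ m = f ∧ k ≤ depth hM Φ m} := by
  induction k with
  | zero => simp [remaining]
  | succ k ih =>
    ext m
    change (m ∈ remaining Φ f k ∧ ¬ BoundsBase (remaining Φ f k) m) ↔ _
    rw [ih, boundsBase_iff_depth_eq hM hΦ]
    simp only [Set.mem_ofPred_eq]
    constructor
    · rintro ⟨⟨h1, h2⟩, h3⟩
      exact ⟨h1, lt_of_le_of_ne h2 fun h => h3 ⟨h1, h.symm⟩⟩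
    · rintro ⟨h1, h2⟩
      exact ⟨⟨h1, by omega⟩, fun h => by omega⟩

theorem hasLevel_iff (hM : IsRightAngled M) {Φ : Wall cs → F}
    (hΦ : ∀ m m' : Wall cs, m ≠ m' → Φ m = Φ m' → Disjoint m.1 m'.1) {m : Wall cs} {n : ℕ} :
    HasLevel Φ m n ↔ n = depth hM Φ m + 1 := by
  unfold HasLevel
  simp only [remaining_eq hM hΦ, boundsBase_iff_depth_eq hM hΦ, true_and]
  constructor
  · rintro ⟨k, rfl, rfl⟩; rfl
  · rintro rfl; exact ⟨_, rfl, rfl⟩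

theorem exists_alternatesByLevel (hM : IsRightAngled M) {Φ : Wall cs → F}
    (hΦ : ∀ m m' : Wall cs, m ≠ m' → Φ m = Φ m' → Disjoint m.1 m'.1) :
    ∃ O : Orientation cs, O.AlternatesByLevel Φ := by
  refine ⟨Orientation.ofSide hM fun m => (-1) ^ depth hM Φ m, fun m =>
    ⟨depth hM Φ m + 1, (hasLevel_iff hM hΦ).2 rfl, ?_⟩⟩
  change basePoint cs ∈ halfSpace m _ ↔ _
  rw [basePoint_mem_halfSpace_iff hM, Nat.odd_add_one, Nat.not_odd_iff_even]
  rcases Nat.even_or_odd (depth hM Φ m) with h | h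
  · simp [h]
  · simp [h.neg_one_pow, Nat.not_even_iff_odd.2 h]

/-- The sign of the chamber `γ C` for the colour `f`: the parity of the number of walls of this
colour that separate it from the base chamber. -/
def colourSign (Φ : Wall cs → F) (γ : W) (f : F) : ℤˣ := (-1) ^ (separating Φ f γ).ncard

theorem colourSign_mul_simple_of_ne (hM : IsRightAngled M) {Φ : Wall cs → F} {f : F} {γ : W}
    {i : B} (h : f ≠ Φ (wallOf cs γ i)) :
    colourSign Φ (γ * cs.simple i) f = colourSign Φ γ f := by
  rw [colourSign, separating_mul_simple_of_ne hM h, colourSign]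

theorem colourSign_mul_simple (hM : IsRightAngled M) (Φ : Wall cs → F) (γ : W) (i : B) :
    colourSign Φ (γ * cs.simple i) (Φ (wallOf cs γ i)) =
      -colourSign Φ γ (Φ (wallOf cs γ i)) := by
  have key : ∀ γ, (wallOf cs γ i).side γ = 1 →
      colourSign Φ (γ * cs.simple i) (Φ (wallOf cs γ i)) =
        -colourSign Φ γ (Φ (wallOf cs γ i)) := by
    intro γ h
    rw [colourSign, ncard_separating_mul_simple hM Φ h, pow_succ, mul_neg_one, colourSign]
  rcases Int.units_eq_one_or ((wallOf cs γ i).side γ) with h | h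
  · exact key γ h
  · have := key (γ * cs.simple i) (by
      rw [wallOf_mul_simple, Wall.side_wallOf hM, h, neg_neg])
    rw [wallOf_mul_simple, cs.simple_mul_simple_cancel_right] at this
    rw [this, neg_neg]

/-- For an orientation that alternates by level, the sign of a face does not depend on its wall but
only on the colour of the wall. -/
theorem resolution_snd_eq (hM : IsRightAngled M) {Φ : Wall cs → F}
    (hΦ : ∀ m m' : Wall cs, m ≠ m' → Φ m = Φ m' → Disjoint m.1 m'.1) {O : Orientation cs}
    (hO : O.AlternatesByLevel Φ) (γ : W) (i : B) :
    (resolution Φ O γ i).2 = colourSign Φ γ (Φ (wallOf cs γ i)) := by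
  obtain ⟨e, he⟩ := exists_left_eq_halfSpace hM O (wallOf cs γ i)
  have he2 : e = (-1) ^ depth hM Φ (wallOf cs γ i) := by
    obtain ⟨n, hn, hodd⟩ := hO (wallOf cs γ i)
    rw [hasLevel_iff hM hΦ] at hn
    subst hn
    rw [he, basePoint_mem_halfSpace_iff hM, Nat.odd_add_one, Nat.not_odd_iff_even] at hodd
    rcases Nat.even_or_odd (depth hM Φ (wallOf cs γ i)) with h | h
    · rw [h.neg_one_pow, hodd.2 h]
    · rw [h.neg_one_pow]
      refine (Int.units_eq_one_or _).resolve_left fun h1 => ?_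
      exact Nat.not_even_iff_odd.2 h (hodd.1 h1)
  have hsign : (resolution Φ O γ i).2 = (wallOf cs γ i).side γ * e := by
    unfold resolution
    dsimp only
    rw [he]
    simp only [interior_chamber_subset_halfSpace_iff hM]
    split_ifs with h
    · rw [h, Int.units_mul_self]
    · rw [Int.units_ne_iff_eq_neg.1 h, neg_mul, Int.units_mul_self]
  rw [hsign, he2]
  rcases Int.units_eq_one_or ((wallOf cs γ i).side γ) with h | h
  · rw [depth_eq hM hΦ rfl h, h, one_mul, colourSign]
  · rw [depth_eq hM hΦ (wallOf_mul_simple cs γ i).symm (by rw [Wall.side_wallOf hM, h, neg_neg]), h,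
      neg_one_mul]
    have := colourSign_mul_simple hM Φ γ i
    rw [colourSign] at this
    rw [this, neg_neg]

end Levels

/-! ### Labellings whose signs depend on the colour only -/

section Coherent

variable {B : Type*} {M : CoxeterMatrix B} {W : Type*} [Group W] {cs : CoxeterSystem M W}
  {F : Type*}

/-- All faces of one colour of a chamber have the same sign, and there is a choice `ε γ f` of this
sign, for the colours without a face as well, such that passing to an adjacent chamber changes only
the sign of the colour of the common face. -/
def IsSignCoherent (cs : CoxeterSystem M W) (φ : W → B → F × ℤˣ) : Prop :=
  ∃ ε : W → F → ℤˣ, ∀ γ i,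
    (φ γ i).2 = ε γ (φ γ i).1 ∧
    (φ (γ * cs.simple i) i).1 = (φ γ i).1 ∧
    ε (γ * cs.simple i) (φ γ i).1 = -ε γ (φ γ i).1 ∧
    ∀ f, f ≠ (φ γ i).1 → ε (γ * cs.simple i) f = ε γ f

theorem IsSignCoherent.isTiling {φ : W → B → F × ℤˣ} (hφ : IsSignCoherent cs φ) :
    IsTiling cs φ := by
  obtain ⟨ε, h⟩ := hφ
  intro γ i
  obtain ⟨h1, h2, h3, -⟩ := h γ i
  refine Prod.ext h2 ?_
  rw [(h (γ * cs.simple i) i).1, h2, h3, ← h1]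
  rfl

variable [Fintype B]

theorem isSignCoherent_resolution (hM : IsRightAngled M) {Φ : Wall cs → F}
    (hΦ : ∀ m m' : Wall cs, m ≠ m' → Φ m = Φ m' → Disjoint m.1 m'.1) {O : Orientation cs}
    (hO : O.AlternatesByLevel Φ) : IsSignCoherent cs (resolution Φ O) := by
  refine ⟨colourSign Φ, fun γ i => ⟨resolution_snd_eq hM hΦ hO γ i, ?_,
    colourSign_mul_simple hM Φ γ i, fun f hf => colourSign_mul_simple_of_ne hM hf⟩⟩
  change Φ (wallOf cs (γ * cs.simple i) i) = Φ (wallOf cs γ i)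
  rw [wallOf_mul_simple]

/-- Cross a face of negative weight as long as there is one. This turns the sign of one colour of
negative weight and changes no other sign, so it ends, at a chamber without faces of negative
weight; the face that was crossed last has positive weight there. -/
theorem IsSignCoherent.exists_sum_pos [Finite F] {φ : W → B → F × ℤˣ} (hφ : IsSignCoherent cs φ)
    {w : F × ℤˣ → ℤ} (hw : ∀ f, w (oppFace f) = -w f) {γ : W} {i : B} (hi : w (φ γ i) ≠ 0) :
    ∃ δ, 0 < ∑ j, w (φ δ j) := by
  have htiling := hφ.isTiling
  obtain ⟨ε, h⟩ := hφ
  induction hn : {f | w (f, ε γ f) < 0}.ncard using Nat.strong_induction_on generalizing γ i with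
  | _ n ih =>
    subst hn
    by_cases hneg : ∃ j, w (φ γ j) < 0
    · obtain ⟨j, hj⟩ := hneg
      obtain ⟨h1, -, h3, h4⟩ := h γ j
      have hpos : w (φ (γ * cs.simple j) j) = -w (φ γ j) := by rw [htiling, hw]
      have hbad : w ((φ γ j).1, ε γ (φ γ j).1) < 0 := by rw [← h1]; exact hj
      have hflip : w ((φ γ j).1, -ε γ (φ γ j).1) = -w ((φ γ j).1, ε γ (φ γ j).1) :=
        hw ((φ γ j).1, ε γ (φ γ j).1)
      refine ih _ ?_ (γ := γ * cs.simple j) (i := j) (by rw [hpos]; omega) rfl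
      refine Set.ncard_lt_ncard ?_ (Set.toFinite _)
      refine (Set.ssubset_iff_of_subset ?_).2 ⟨(φ γ j).1, hbad, ?_⟩
      · intro f hf
        by_cases hfj : f = (φ γ j).1
        · subst hfj
          exact hbad
        · rwa [Set.mem_ofPred_eq, h4 f hfj] at hf
      · rw [Set.mem_ofPred_eq, h3, hflip]
        omega
    · push Not at hneg
      exact ⟨γ, Finset.sum_pos' (fun j _ => hneg j)
        ⟨i, Finset.mem_univ i, lt_of_le_of_ne (hneg i) (Ne.symm hi)⟩⟩

open Classical in
theorem IsSignCoherent.strictlyBalanced [Finite F] {φ : W → B → F × ℤˣ}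
    (hφ : IsSignCoherent cs φ) : (tileSet φ).StrictlyBalanced := by
  intro w hw hw0
  -- the weight is extended by zero to the labels that do not occur
  let p : F × ℤˣ → Prop := fun f => ∃ γ s, φ γ s = f ∨ φ γ s = oppFace f
  have hopp : ∀ f : F × ℤˣ, oppFace (oppFace f) = f := fun f => by simp [oppFace]
  have hp : ∀ f, p (oppFace f) ↔ p f := by
    intro f
    refine exists_congr fun γ => exists_congr fun s => ?_
    rw [hopp, or_comm]
  let v : F × ℤˣ → ℤ := fun f => if h : p f then w ⟨f, h⟩ else 0
  have hvw : ∀ f (h : p f), v f = w ⟨f, h⟩ := fun f h => dif_pos h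
  have hv : ∀ f, v (oppFace f) = -v f := by
    intro f
    by_cases h : p f
    · rw [hvw _ h, hvw _ ((hp f).2 h)]
      exact hw ⟨f, h⟩
    · simp only [v, dif_neg h, dif_neg (mt (hp f).1 h), neg_zero]
  have hsum : ∀ γ (t : (tileSet φ).Tile), t = ⟨φ γ, γ, rfl⟩ →
      (((tileSet φ).faces t).map w).sum = ∑ s, v (φ γ s) := by
    rintro γ _ rfl
    refine congrArg Multiset.sum ((Multiset.map_map _ _ _).trans
      (Multiset.map_congr rfl fun s _ => ?_))
    exact (hvw (φ γ s) ⟨γ, s, Or.inl rfl⟩).symm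
  obtain ⟨γ, s, hs⟩ : ∃ γ s, v (φ γ s) ≠ 0 := by
    obtain ⟨f, hf⟩ := Function.ne_iff.1 hw0
    have hvf : v f.1 ≠ 0 := by
      rw [hvw f.1 f.2]
      exact hf
    obtain ⟨γ, s, h | h⟩ := f.2
    · exact ⟨γ, s, by rwa [h]⟩
    · refine ⟨γ, s, ?_⟩
      rw [h, hv]
      exact neg_ne_zero.2 hvf
  constructor
  · obtain ⟨δ, hδ⟩ := hφ.exists_sum_pos hv hs
    exact ⟨⟨φ δ, δ, rfl⟩, by rwa [hsum δ _ rfl]⟩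
  · obtain ⟨δ, hδ⟩ := hφ.exists_sum_pos (w := -v) (fun f => by simp [hv]) (i := s) (γ := γ)
      (by simpa using hs)
    refine ⟨⟨φ δ, δ, rfl⟩, ?_⟩
    rw [hsum δ _ rfl]
    simpa using hδ

/-! ### Limit tilings -/

theorem face_mul_simple (cs : CoxeterSystem M W) (γ : W) (i : B) :
    face cs (γ * cs.simple i) i = face cs γ i := by
  have key : ∀ γ, face cs γ i ⊆ face cs (γ * cs.simple i) i := by
    rintro γ _ ⟨⟨x, rfl⟩, hx⟩
    refine ⟨⟨x, toDavis_mul_simple_eq cs hx⟩, ?_⟩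
    rwa [wallOf_mul_simple]
  refine Set.Subset.antisymm ?_ (key γ)
  have := key (γ * cs.simple i)
  rwa [cs.simple_mul_simple_cancel_right] at this

/-- Two different chambers with a common face are adjacent across it. -/
theorem eq_mul_simple_of_face_eq (hM : IsRightAngled M) (cs : CoxeterSystem M W) {γ δ : W}
    {i j : B} (hne : γ ≠ δ) (h : face cs γ i = face cs δ j) : δ = γ * cs.simple i ∧ j = i := by
  have hv : toDavis cs γ (coneVertex M {i} (isNerveSimplex_singleton M i)) ∈ face cs γ i :=
    ⟨⟨_, rfl⟩, (toDavis_coneVertex_mem_wall cs).2 rfl⟩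
  obtain ⟨⟨y, hy⟩, hw⟩ := h ▸ hv
  rw [toDavis_coneVertex_mem_wall] at hw
  obtain ⟨rfl, h'⟩ := (toDavis_eq_iff cs).1 hy.symm
  have := h' {i} (coneVertex_apply_ne_zero.2 rfl)
  rw [mem_simplexSubgroup_singleton, inv_mul_eq_one] at this
  have hδ : δ = γ * cs.simple i := inv_mul_eq_iff_eq_mul.1 (this.resolve_left hne)
  refine ⟨hδ, ?_⟩
  rw [← wallOf_mul_simple cs γ, ← hδ, eq_wallOf_iff, reflection_wallOf, mul_left_inj,
    mul_right_inj] at hw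
  exact simple_injective hM cs hw

theorem IsPullbackAt.exists_adjacent (hM : IsRightAngled M)
    {g : DavisComplex cs ≃ₜ DavisComplex cs} {φ ψ : W → B → F × ℤˣ} {τ : W → W}
    (hτ : ∀ γ, g '' chamber cs γ = chamber cs (τ γ)) {γ : W} {i : B}
    (h : IsPullbackAt g φ ψ γ) (h' : IsPullbackAt g φ ψ (γ * cs.simple i)) :
    ∃ j, τ (γ * cs.simple i) = τ γ * cs.simple j ∧ ψ γ i = φ (τ γ) j ∧
      ψ (γ * cs.simple i) i = φ (τ γ * cs.simple j) j := by
  obtain ⟨γ', hγ', hs⟩ := h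
  obtain ⟨δ', hδ', hs'⟩ := h'
  obtain rfl : τ γ = γ' := chamber_injective cs ((hτ γ).symm.trans hγ')
  obtain rfl : τ (γ * cs.simple i) = δ' := chamber_injective cs ((hτ _).symm.trans hδ')
  obtain ⟨j, hj, hψ⟩ := hs i
  obtain ⟨k, hk, hψ'⟩ := hs' i
  rw [face_mul_simple, hj] at hk
  have hne : τ γ ≠ τ (γ * cs.simple i) := by
    intro h
    have h1 : g '' chamber cs γ = g '' chamber cs (γ * cs.simple i) := by rw [hτ, hτ, h]
    have h2 := chamber_injective cs (g.injective.image_injective h1)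
    exact simple_ne_one cs i (mul_eq_left.1 h2.symm)
  obtain ⟨h1, rfl⟩ := eq_mul_simple_of_face_eq hM cs hne hk
  exact ⟨k, h1, hψ, h1 ▸ hψ'⟩

/-- The signs of the colours pass to limits: those of the pulled back labellings take finitely many
values, so they converge along an ultrafilter. -/
theorem IsSignCoherent.of_isLimitTiling (hM : IsRightAngled M) {φ ψ : W → B → F × ℤˣ}
    (hφ : IsSignCoherent cs φ) (hψ : IsLimitTiling cs φ ψ) : IsSignCoherent cs ψ := by
  obtain ⟨ε, h⟩ := hφ
  obtain ⟨g, hg, hlim⟩ := hψ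
  choose τ hτ using hg
  let U : Ultrafilter ℕ := Filter.hyperfilter ℕ
  have hU : ∀ γ, ∀ᶠ n in (U : Filter ℕ), IsPullbackAt (g n) φ ψ γ := by
    intro γ
    obtain ⟨n₀, hn₀⟩ := hlim γ
    exact (Filter.eventually_ge_atTop n₀).filter_mono
      Nat.hyperfilter_le_atTop |>.mono hn₀
  have hconv : ∀ γ f, ∃ e, ∀ᶠ n in (U : Filter ℕ), ε (τ n γ) f = e := by
    intro γ f
    by_cases h1 : ∀ᶠ n in (U : Filter ℕ), ε (τ n γ) f = 1
    · exact ⟨1, h1⟩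
    · refine ⟨-1, (Ultrafilter.eventually_not.2 h1).mono fun n hn => ?_⟩
      exact (Int.units_eq_one_or _).resolve_left hn
  choose ε' hε' using hconv
  refine ⟨ε', fun γ i => ?_⟩
  have hadj : ∀ᶠ n in (U : Filter ℕ), ∃ j, τ n (γ * cs.simple i) = τ n γ * cs.simple j ∧
      ψ γ i = φ (τ n γ) j ∧ ψ (γ * cs.simple i) i = φ (τ n γ * cs.simple j) j := by
    filter_upwards [hU γ, hU (γ * cs.simple i)] with n hn hn'
    exact IsPullbackAt.exists_adjacent hM (hτ n) hn hn'
  refine ⟨?_, ?_, ?_, fun f hf => ?_⟩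
  · obtain ⟨n, ⟨j, -, hj, -⟩, hn⟩ := (hadj.and (hε' γ (ψ γ i).1)).exists
    rw [← hn, hj]
    exact (h _ j).1
  · obtain ⟨n, j, -, hj, hj'⟩ := hadj.exists
    rw [hj, hj']
    exact (h _ j).2.1
  · obtain ⟨n, ⟨⟨j, hτj, hj, -⟩, hn⟩, hn'⟩ :=
      ((hadj.and (hε' γ (ψ γ i).1)).and (hε' (γ * cs.simple i) (ψ γ i).1)).exists
    rw [← hn, ← hn', hτj, hj]
    exact (h _ j).2.2.1
  · obtain ⟨n, ⟨⟨j, hτj, hj, -⟩, hn⟩, hn'⟩ :=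
      ((hadj.and (hε' γ f)).and (hε' (γ * cs.simple i) f)).exists
    rw [← hn, ← hn', hτj]
    exact (h _ j).2.2.2 f (hj ▸ hf)

end Coherent

end DavisTiling

end

theorem mainTheorem3 {B : Type*} [Fintype B] {M : CoxeterMatrix B}
    (hM : DavisTiling.IsRightAngled M) {W : Type*} [Group W] (cs : CoxeterSystem M W)
    {F : Type*} [Finite F] (Φ : DavisTiling.Wall cs → F)
    (hΦ : ∀ m m' : DavisTiling.Wall cs, m ≠ m' → Φ m = Φ m' → Disjoint m.1 m'.1) :
    (∃ O : DavisTiling.Orientation cs, O.AlternatesByLevel Φ) ∧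
    ∀ O : DavisTiling.Orientation cs, O.AlternatesByLevel Φ →
      DavisTiling.IsTiling cs (DavisTiling.resolution Φ O) ∧
      (DavisTiling.tileSet (DavisTiling.resolution Φ O)).StrictlyBalanced ∧
      ∀ ψ : W → B → F × ℤˣ,
        DavisTiling.IsLimitTiling cs (DavisTiling.resolution Φ O) ψ →
          DavisTiling.IsTiling cs ψ ∧ (DavisTiling.tileSet ψ).StrictlyBalanced := by
  refine ⟨DavisTiling.exists_alternatesByLevel hM hΦ, fun O hO => ?_⟩
  have hcoh := DavisTiling.isSignCoherent_resolution hM hΦ hO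
  refine ⟨hcoh.isTiling, hcoh.strictlyBalanced, fun ψ hψ => ?_⟩
  have hψcoh := hcoh.of_isLimitTiling hM hψ
  exact ⟨hψcoh.isTiling, hψcoh.strictlyBalanced⟩
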